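/- Theorem 5 (Cluster center estimation error). Model. Let $n\ge 4$, $k\ge 2$ and $d$ be integers, $\boldsymbol\mu_1,\dots,\boldsymbol\mu_k\in\mathbb R^d$, $\sigma^*:[n]\to[k]$ with $|\{i:\sigma^*(i)=a\}|=n/k$ for every $a\in[k]$, and $\tau>0$. One observes $\mathbf h_i=\boldsymbol\mu_{\sigma^*(i)}+\mathbf g_i$, $i\in[n]$, where $\mathbf g_1,\dots,\mathbf g_n$ are independent centered random vectors in $\mathbb R^d$ with sub-Gaussian norms $\|\mathbf g_i\|_{\psi_2}\le\tau$. Here $\|X\|_{\psi_2}=\inf\{t>0:\mathbb E\exp(X^2/t^2)\le 2\}$ for a real random variable $X$, and $\|\mathbf x\|_{\psi_2}=\sup_{\|\mathbf u\|_2=1}\|\langle\mathbf x,\mathbf u\rangle\|_{\psi_2}$ for a random vector $\mathbf x$. Put $\Delta_{ab}=\|\boldsymbol\mu_a-\boldsymbol\mu_b\|_2$, $\Delta=\min_{a\ne b}\Delta_{ab}$ and $s=\Delta/\tau$. Estimator. Let $A_{ij}=\|\mathbf h_i-\mathbf h_j\|_2^2$, and let $\widehat{\mathbf Y}$ be any minimizer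 of $\operatorname{Tr}(\mathbf Y^\top\mathbf A)$ over the positive semidefinite matrices $\mathbf Y\in\mathbb R^{n\times n}$ with $\mathbf Y\mathbf 1=\frac nk\mathbf 1$, $Y_{ii}=1$ for all $i$, and $Y_{ij}\ge 0$ for all $i,j$. Labels $\widehat\sigma:[n]\to[k]$ are obtained from $\widehat{\mathbf Y}$ in two steps. (1) Start with $V=[n]$. While $V\neq\emptyset$: for $u\in V$ let $B(u)=\{w\in V:\|\widehat{\mathbf Y}_{u\bullet}-\widehat{\mathbf Y}_{w\bullet}\|_1\le\frac n{4k}\}$; take a set $B(u)$ with the largest number of elements; if it has more than $n/k$ elements, remove arbitrary ones so that $n/k$ remain; output the resulting set and remove it from $V$. (2) Choose $k$ largest of the sets that were output, call them $U_1,\dots,U_k$, distribute the points outside them arbitrarily among $U_1,\dots,U_k$ so that each has exactly $n/k$ elements, and put $\widehat\sigma_i=t$ if $i\in U_t$. Finally, let $\hat{\boldsymbol\mu}_a=\frac kn\sum_{i:\widehat\sigma_i=a}\mathbf h_i$ for $a\in[k]$. Claim. There is a universal constant $C_s>0$ such that for every constant $C_q>0$ there are constants $C_m,C_e>0$, depending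 only on $C_q$, for which the following holds. If $\max_{a,b\in[k]}\Delta_{ab}\le C_q\Delta$ and $$s^2\ge C_s\left(\sqrt{\frac{kd}{n}\log n}+\frac{kd}{n}+k\right),$$ then with probability at least $1-4n^{-1}$, for every minimizer $\widehat{\mathbf Y}$ and all choices left open in the two steps, $$\max_{a\in[k]}\min_{\pi\in\mathcal S_k}\|\hat{\boldsymbol\mu}_a-\boldsymbol\mu_{\pi(a)}\|_2\le C_m\tau\left(\sqrt{\frac{k(d+\log n)}{n}}+\sqrt{d+\log n}\cdot\exp\left[-\frac{s^2}{C_e}\right]\right),$$ where $\mathcal S_k$ is the set of permutations of $[k]$. -/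

import Mathlib

open MeasureTheory ProbabilityTheory
open scoped ENNReal Matrix

noncomputable section

/-! Sub-Gaussian mixture model -/

/-- The sub-Gaussian norm `inf {t > 0 : E exp (X² / t²) ≤ 2}` of a real random variable,
with value `∞` if there is no such `t`. -/
def psi2Norm {Ω : Type*} [MeasurableSpace Ω] (P : Measure Ω) (X : Ω → ℝ) : ℝ≥0∞ :=
  ⨅ (t : ℝ) (_ : 0 < t ∧ ∫⁻ ω, ENNReal.ofReal (Real.exp (X ω ^ 2 / t ^ 2)) ∂P ≤ 2),
    ENNReal.ofReal t

/-- The sub-Gaussian norm of a random vector: the supremum of the sub-Gaussian norms of its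
one-dimensional marginals in the directions of the unit sphere. -/
def psi2NormVec {Ω : Type*} [MeasurableSpace Ω] (P : Measure Ω) {d : ℕ}
    (g : Ω → EuclideanSpace ℝ (Fin d)) : ℝ≥0∞ :=
  ⨆ (u : EuclideanSpace ℝ (Fin d)) (_ : ‖u‖ = 1), psi2Norm P (fun ω => inner ℝ (g ω) u)

/-- The balanced sub-Gaussian mixture model with `n` points and `k` clusters in dimension `d`:
`σ` is the vector of true labels, the noise vectors `g i` are independent, centered, with
sub-Gaussian norm at most `τ`, and all clusters have size `n / k`. -/
structure IsSGMM {Ω : Type*} [MeasurableSpace Ω] (P : Measure Ω) {n k d : ℕ} (τ : ℝ)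
    (σ : Fin n → Fin k) (g : Fin n → Ω → EuclideanSpace ℝ (Fin d)) : Prop where
  measurable : ∀ i, Measurable (g i)
  indep : iIndepFun g P
  mean_zero : ∀ i, ∫ ω, g i ω ∂P = 0
  subgaussian : ∀ i, psi2NormVec P (g i) ≤ ENNReal.ofReal τ
  balanced : ∀ a, ((Finset.univ.filter (fun i => σ i = a)).card : ℝ) = (n : ℝ) / k

/-- The observed points `h i = μ (σ i) + g i` (for one realization of the noise). -/
def sgmmData {n k d : ℕ} (μ : Fin k → EuclideanSpace ℝ (Fin d)) (σ : Fin n → Fin k)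
    (g : Fin n → EuclideanSpace ℝ (Fin d)) (i : Fin n) : EuclideanSpace ℝ (Fin d) :=
  μ (σ i) + g i

/-- The separation of the centers of clusters `a` and `b`. -/
def centerSep {k d : ℕ} (μ : Fin k → EuclideanSpace ℝ (Fin d)) (a b : Fin k) : ℝ :=
  ‖μ a - μ b‖

/-- The minimum separation of the centers (a minimum over a finite set, nonempty if `2 ≤ k`). -/
def minSep {k d : ℕ} (μ : Fin k → EuclideanSpace ℝ (Fin d)) : ℝ :=
  ⨅ p : {p : Fin k × Fin k // p.1 ≠ p.2}, centerSep μ p.1.1 p.1.2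

/-- The signal-to-noise ratio. -/
def snr {k d : ℕ} (μ : Fin k → EuclideanSpace ℝ (Fin d)) (τ : ℝ) : ℝ :=
  minSep μ / τ

/-- The condition on the signal-to-noise ratio `s`, with constant `Cs`. -/
def SNRCondition (Cs : ℝ) (n k d : ℕ) (s : ℝ) : Prop :=
  Cs * (Real.sqrt ((k : ℝ) * d / n * Real.log n) + (k : ℝ) * d / n + k) ≤ s ^ 2

/-! Semidefinite relaxation -/

/-- The matrix of pairwise squared distances. -/
def sqDistMatrix {n d : ℕ} (h : Fin n → EuclideanSpace ℝ (Fin d)) :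
    Matrix (Fin n) (Fin n) ℝ :=
  Matrix.of fun i j => ‖h i - h j‖ ^ 2

/-- The feasible set of the semidefinite program. -/
structure IsSDPFeasible {n : ℕ} (k : ℕ) (Y : Matrix (Fin n) (Fin n) ℝ) : Prop where
  row_sum : Y *ᵥ (fun _ => 1) = fun _ => (n : ℝ) / k
  psd : Y.PosSemidef
  diag : ∀ i, Y i i = 1
  nonneg : ∀ i j, 0 ≤ Y i j

/-- `Y` is an optimal solution of the semidefinite program with data `h`: it minimizes the trace
inner product with the matrix of pairwise squared distances over the feasible set. -/
def IsSDPSolution {n d : ℕ} (k : ℕ) (h : Fin n → EuclideanSpace ℝ (Fin d))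
    (Y : Matrix (Fin n) (Fin n) ℝ) : Prop :=
  IsSDPFeasible k Y ∧
    ∀ Z : Matrix (Fin n) (Fin n) ℝ, IsSDPFeasible k Z →
      (Yᵀ * sqDistMatrix h).trace ≤ (Zᵀ * sqDistMatrix h).trace

/-! Rounding procedure -/

/-- Among the remaining indices `V`, those whose row of `Y` is within `ℓ₁` distance `n / (4 k)`
of the row of index `u`. -/
def rowBall {n : ℕ} (k : ℕ) (Y : Matrix (Fin n) (Fin n) ℝ) (V : Finset (Fin n)) (u : Fin n) :
    Finset (Fin n) :=
  V.filter (fun w => ∑ j, |Y u j - Y w j| ≤ (n : ℝ) / (4 * k))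

/-- `B` can be extracted from the remaining indices `V`: it is a ball with the largest number of
elements, from which arbitrary elements have been removed to bring it down to `n / k` elements
if it has more than that. -/
def IsExtraction {n : ℕ} (k : ℕ) (Y : Matrix (Fin n) (Fin n) ℝ) (V B : Finset (Fin n)) : Prop :=
  ∃ u ∈ V, (∀ v ∈ V, (rowBall k Y V v).card ≤ (rowBall k Y V u).card) ∧
    B ⊆ rowBall k Y V u ∧ (B.card : ℝ) = min ((rowBall k Y V u).card : ℝ) ((n : ℝ) / k)

/-- `FirstStep k Y V Bs`: started with the remaining indices `V`, the loop of the first step may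
extract the successive sets `Bs`, until no index remains. -/
inductive FirstStep {n : ℕ} (k : ℕ) (Y : Matrix (Fin n) (Fin n) ℝ) :
    Finset (Fin n) → List (Finset (Fin n)) → Prop
  | done : FirstStep k Y ∅ []
  | extract (V B : Finset (Fin n)) (Bs : List (Finset (Fin n))) :
      IsExtraction k Y V B → FirstStep k Y (V \ B) Bs → FirstStep k Y V (B :: Bs)

/-- `σ'` is a possible output of the second step on the sets `Bs`: `k` largest sets
`U t = Bs.get (e t)` are chosen, their elements get the label `t`, and the other points are
distributed arbitrarily so that each label is used exactly `n / k` times. -/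
def SecondStep {n k : ℕ} (Bs : List (Finset (Fin n))) (σ' : Fin n → Fin k) : Prop :=
  ∃ e : Fin k ↪ Fin Bs.length,
    (∀ s, s ∉ Set.range e → ∀ t, (Bs.get s).card ≤ (Bs.get (e t)).card) ∧
    (∀ t, ∀ i ∈ Bs.get (e t), σ' i = t) ∧
    ∀ t, ((Finset.univ.filter (fun i => σ' i = t)).card : ℝ) = (n : ℝ) / k

/-- `σ'` is a possible output of the two-step rounding procedure with input matrix `Y`. -/
def IsClusterOutput {n k : ℕ} (Y : Matrix (Fin n) (Fin n) ℝ) (σ' : Fin n → Fin k) : Prop :=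
  ∃ Bs : List (Finset (Fin n)), FirstStep k Y Finset.univ Bs ∧ SecondStep Bs σ'

/-! Center estimation -/

/-- The empirical mean `(k / n) ∑_{i : σ' i = a} h i` of the estimated cluster `a`. -/
def centerEstimate {n k d : ℕ} (h : Fin n → EuclideanSpace ℝ (Fin d)) (σ' : Fin n → Fin k)
    (a : Fin k) : EuclideanSpace ℝ (Fin d) :=
  ((k : ℝ) / n) • ∑ i ∈ Finset.univ.filter (fun i => σ' i = a), h i

/-- The estimation error `max_a min_π ‖ν a - μ (π a)‖` of the centers. -/
def centerError {k d : ℕ} (ν μ : Fin k → EuclideanSpace ℝ (Fin d)) : ℝ :=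
  ⨆ a : Fin k, ⨅ π : Equiv.Perm (Fin k), ‖ν a - μ (π a)‖

end

open scoped NNReal

/-! ### Sub-Gaussian random variables and vectors -/

/-! Write `S` for the true cluster matrix, `W = Y - S`, `m = n / k`, `R` for the mass that `Y` puts
across clusters, and `D = ∑ Y i j ‖μ (σ i) - μ (σ j)‖²`, so that `Δ² R ≤ D`. Rows and columns of `W`
sum to zero, so comparing `Y` with `S` bounds `D / 2` by a signal-noise term plus the pairing of `W`
with the Gram matrix of the noise (`IsSDPSolution.basic_inequality`).

The pure noise term is at most `D / 8` and is absorbed: off the cluster-constant vectors `W`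
coincides with the positive semidefinite `Y`, where operator norm times trace suffices; the
remaining pieces involve only cluster averages of the noise, controlled entrywise
(`frobInner_noise_le`). In the signal-noise term, each inner product minus a fraction of the squared
separation is bounded by an exponential that depends on one point `j`. As the columns of `Y` sum to
`m`, this leaves a sum of independent variables whose second moments are exponentially small in
`s²`; Chebyshev's inequality suffices. Since `k ≤ s²`, this gives `R ≲ m² s² exp (-s² / 8192)`.

By Markov's inequality few rows of `Y` are far from those of `S`. Good rows of one cluster lie in a
common ball, and no ball meets good rows of two clusters, so each estimated cluster agrees with some
true cluster up to twice the number of bad rows (`IsClusterOutput.exists_card_le`). Its mean is then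
off by the noise average of the true cluster, which gives the first error term, plus the misplaced
points, each costing at most `Cq Δ` and noise norms, which gives the second. The permutation may
depend on the cluster, so no global matching of labels is needed. -/

theorem exp_le_add_exp_sq (x : ℝ) : Real.exp x ≤ x + Real.exp (x ^ 2) := by
  rcases le_or_gt |x| 1 with h | h
  · have h1 := Real.abs_exp_sub_one_sub_id_le h
    have h2 := Real.add_one_le_exp (x ^ 2)
    have h3 := (abs_le.mp h1).2
    linarith
  · rcases lt_abs.mp h with h | h
    · have : Real.exp x ≤ Real.exp (x ^ 2) := Real.exp_le_exp.mpr (by nlinarith)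
      linarith
    · have h1 : Real.exp x ≤ 1 := Real.exp_le_one_iff.mpr (by linarith)
      have h2 := Real.add_one_le_exp (x ^ 2)
      nlinarith

section

variable {Ω : Type*} [MeasurableSpace Ω] {P : Measure Ω}

theorem hasSubgaussianMGF_mono {X : Ω → ℝ} {c c' : ℝ≥0} (h : HasSubgaussianMGF X c P)
    (hc : c ≤ c') : HasSubgaussianMGF X c' P where
  integrable_exp_mul := h.integrable_exp_mul
  mgf_le t := (h.mgf_le t).trans (Real.exp_le_exp.mpr (by
    have : (c : ℝ) ≤ c' := hc
    gcongr))

theorem lintegral_exp_sq_le_of_psi2Norm_lt {X : Ω → ℝ} {τ : ℝ}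
    (h : psi2Norm P X < ENNReal.ofReal τ) :
    ∫⁻ ω, ENNReal.ofReal (Real.exp (X ω ^ 2 / τ ^ 2)) ∂P ≤ 2 := by
  unfold psi2Norm at h
  rw [iInf_lt_iff] at h
  obtain ⟨t, h⟩ := h
  rw [iInf_lt_iff] at h
  obtain ⟨⟨ht, hle⟩, h⟩ := h
  have htτ : t < τ := (ENNReal.ofReal_lt_ofReal_iff_of_nonneg ht.le).mp h
  refine (lintegral_mono fun ω => ?_).trans hle
  gcongr

theorem hasSubgaussianMGF_const_mul {X : Ω → ℝ} {c : ℝ≥0} (h : HasSubgaussianMGF X c P) (r : ℝ) :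
    HasSubgaussianMGF (fun ω => r * X ω) (‖r‖₊ ^ 2 * c) P := by
  refine hasSubgaussianMGF_mono (h.const_mul r) (le_of_eq ?_)
  congr 1
  exact NNReal.eq (sq_abs r).symm

theorem integrable_exp_sq_of_lintegral_le {X : Ω → ℝ} {K : ℝ} (hX : Measurable X)
    (h : ∫⁻ ω, ENNReal.ofReal (Real.exp (X ω ^ 2 / K ^ 2)) ∂P ≤ 2) :
    Integrable (fun ω => Real.exp (X ω ^ 2 / K ^ 2)) P := by
  refine ⟨by fun_prop, ?_⟩
  rw [hasFiniteIntegral_iff_ofReal (ae_of_all _ fun _ => (Real.exp_pos _).le)]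
  exact h.trans_lt (by simp)

theorem integrable_of_integrable_exp_sq {X : Ω → ℝ} {K : ℝ} (hK : 0 < K) (hX : Measurable X)
    (hint : Integrable (fun ω => Real.exp (X ω ^ 2 / K ^ 2)) P) : Integrable X P := by
  refine (hint.const_mul K).mono' hX.aestronglyMeasurable (ae_of_all _ fun ω => ?_)
  have h1 := Real.add_one_le_exp (X ω ^ 2 / K ^ 2)
  have h2 : |X ω| ≤ K * (X ω ^ 2 / K ^ 2 + 1) := by
    have : K * (X ω ^ 2 / K ^ 2 + 1) = (|X ω| ^ 2 + K ^ 2) / K := by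
      rw [sq_abs]; field_simp
    rw [this, le_div_iff₀ hK]
    nlinarith [sq_nonneg (|X ω| - K), abs_nonneg (X ω), sq_nonneg (|X ω|), sq_nonneg K]
  rw [Real.norm_eq_abs]
  exact h2.trans (by gcongr)

/-- A centered random variable `X` with `E exp (X² / K²) ≤ 2` satisfies
`E exp (λ X) ≤ exp (K² λ²)`. -/
theorem hasSubgaussianMGF_of_lintegral_exp_sq_le [IsProbabilityMeasure P] {X : Ω → ℝ} {K : ℝ}
    (hK : 0 < K) (hX : Measurable X) (h0 : ∫ ω, X ω ∂P = 0)
    (h : ∫⁻ ω, ENNReal.ofReal (Real.exp (X ω ^ 2 / K ^ 2)) ∂P ≤ 2) :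
    HasSubgaussianMGF X (Real.toNNReal (2 * K ^ 2)) P := by
  have hint := integrable_exp_sq_of_lintegral_le hX h
  have hint2 : ∫ ω, Real.exp (X ω ^ 2 / K ^ 2) ∂P ≤ 2 := by
    rw [integral_eq_lintegral_of_nonneg_ae (ae_of_all _ fun _ => (Real.exp_pos _).le) (by fun_prop)]
    exact ENNReal.toReal_le_of_le_ofReal (by norm_num) (by simpa using h)
  have hpow : ∀ p : ℝ, 0 ≤ p → p ≤ 1 →
      Integrable (fun ω => Real.exp (p * (X ω ^ 2 / K ^ 2))) P ∧
        ∫ ω, Real.exp (p * (X ω ^ 2 / K ^ 2)) ∂P ≤ Real.exp (p * Real.log 2) := by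
    intro p hp0 hp1
    have hi : Integrable (fun ω => Real.exp (p * (X ω ^ 2 / K ^ 2))) P := by
      refine hint.mono (by fun_prop) (ae_of_all _ fun ω => ?_)
      rw [Real.norm_of_nonneg (Real.exp_pos _).le, Real.norm_of_nonneg (Real.exp_pos _).le]
      refine Real.exp_le_exp.mpr ?_
      have : 0 ≤ X ω ^ 2 / K ^ 2 := by positivity
      nlinarith
    refine ⟨hi, ?_⟩
    have hj := (Real.concaveOn_rpow hp0 hp1).le_map_integral (μ := P)
      (f := fun ω => Real.exp (X ω ^ 2 / K ^ 2))
      (Real.continuous_rpow_const hp0).continuousOn isClosed_Ici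
      (ae_of_all _ fun ω => (Real.exp_pos _).le) hint (by
        refine hi.congr (ae_of_all _ fun ω => ?_)
        simp only [Function.comp]
        rw [← Real.exp_mul, mul_comm])
    have he : ∫ ω, Real.exp (p * (X ω ^ 2 / K ^ 2)) ∂P
        = ∫ ω, (Real.exp (X ω ^ 2 / K ^ 2)) ^ p ∂P := by
      refine integral_congr_ae (ae_of_all _ fun ω => ?_)
      simp only
      rw [← Real.exp_mul, mul_comm]
    rw [he]
    refine hj.trans ?_
    have : Real.exp (p * Real.log 2) = (2 : ℝ) ^ p := by
      rw [Real.rpow_def_of_pos (by norm_num), mul_comm]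
    rw [this]
    exact Real.rpow_le_rpow (integral_nonneg fun _ => (Real.exp_pos _).le) hint2 hp0
  have hl2 : Real.log 2 ≤ 1 := by have := Real.log_two_lt_d9; linarith
  have hXi := integrable_of_integrable_exp_sq hK hX hint
  obtain ⟨hhalf, hhalf2⟩ := hpow (1 / 2) (by norm_num) (by norm_num)
  have hdom : ∀ t ω, Real.exp (t * X ω) ≤
      Real.exp (t ^ 2 * K ^ 2 / 2) * Real.exp (1 / 2 * (X ω ^ 2 / K ^ 2)) := by
    intro t ω
    rw [← Real.exp_add]
    refine Real.exp_le_exp.mpr ?_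
    have : t ^ 2 * K ^ 2 / 2 + 1 / 2 * (X ω ^ 2 / K ^ 2) - t * X ω
        = (t * K - X ω / K) ^ 2 / 2 := by field_simp; ring
    have := sq_nonneg (t * K - X ω / K)
    linarith
  have hbd : ∀ t : ℝ, Integrable (fun ω => Real.exp (t * X ω)) P ∧
      ∫ ω, Real.exp (t * X ω) ∂P ≤ Real.exp (K ^ 2 * t ^ 2) := by
    intro t
    have hexpi : Integrable (fun ω => Real.exp (t * X ω)) P := by
      refine (hhalf.const_mul (Real.exp (t ^ 2 * K ^ 2 / 2))).mono' (by fun_prop)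
        (ae_of_all _ fun ω => ?_)
      rw [Real.norm_of_nonneg (Real.exp_pos _).le]
      exact hdom t ω
    refine ⟨hexpi, ?_⟩
    -- For small `t` the linear term of `exp_le_add_exp_sq` integrates to zero and Jensen applies
    -- with `p = t² K²`; for large `t` the AM-GM bound `hdom` suffices.
    rcases le_or_gt (t ^ 2 * K ^ 2) 1 with ht | ht
    · obtain ⟨hi, hle⟩ := hpow (t ^ 2 * K ^ 2) (by positivity) ht
      have heq : ∀ ω, t ^ 2 * K ^ 2 * (X ω ^ 2 / K ^ 2) = (t * X ω) ^ 2 := by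
        intro ω; field_simp
      simp only [heq] at hi hle
      calc ∫ ω, Real.exp (t * X ω) ∂P ≤ ∫ ω, (t * X ω + Real.exp ((t * X ω) ^ 2)) ∂P :=
            integral_mono hexpi ((hXi.const_mul t).add hi) fun ω => exp_le_add_exp_sq _
        _ = ∫ ω, Real.exp ((t * X ω) ^ 2) ∂P := by
            rw [integral_add (hXi.const_mul t) hi, integral_const_mul, h0]; simp
        _ ≤ _ := hle
        _ ≤ _ := Real.exp_le_exp.mpr (by
            have : 0 ≤ t ^ 2 * K ^ 2 := by positivity
            nlinarith)
    · calc ∫ ω, Real.exp (t * X ω) ∂P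
          ≤ ∫ ω, Real.exp (t ^ 2 * K ^ 2 / 2) * Real.exp (1 / 2 * (X ω ^ 2 / K ^ 2)) ∂P :=
            integral_mono hexpi (hhalf.const_mul _) fun ω => hdom t ω
        _ = Real.exp (t ^ 2 * K ^ 2 / 2) * ∫ ω, Real.exp (1 / 2 * (X ω ^ 2 / K ^ 2)) ∂P :=
            integral_const_mul _ _
        _ ≤ Real.exp (t ^ 2 * K ^ 2 / 2) * Real.exp (1 / 2 * Real.log 2) := by gcongr
        _ ≤ _ := by
            rw [← Real.exp_add]
            refine Real.exp_le_exp.mpr ?_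
            nlinarith
  refine ⟨fun t => (hbd t).1, fun t => ?_⟩
  refine (hbd t).2.trans_eq ?_
  rw [Real.coe_toNNReal _ (by positivity)]
  congr 1; ring

/-- All one-dimensional marginals `⟨X, u⟩` are sub-Gaussian with variance proxy `c ‖u‖²`. -/
def IsSubgaussianVec {d : ℕ} (X : Ω → EuclideanSpace ℝ (Fin d)) (c : ℝ≥0) (P : Measure Ω) : Prop :=
  ∀ u, HasSubgaussianMGF (fun ω => inner ℝ (X ω) u) (c * ‖u‖₊ ^ 2) P

variable {d : ℕ}

/-- Needed because the Bochner integral of a non-integrable map is 0 by convention, so the centering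
hypothesis alone says nothing about the marginals. -/
theorem integrable_of_forall_integrable_inner {X : Ω → EuclideanSpace ℝ (Fin d)}
    (h : ∀ u : EuclideanSpace ℝ (Fin d), ‖u‖ = 1 → Integrable (fun ω => inner ℝ (X ω) u) P) :
    Integrable X P := by
  have hX : X = fun ω => ∑ i, inner ℝ (X ω) (EuclideanSpace.basisFun (Fin d) ℝ i) •
      EuclideanSpace.basisFun (Fin d) ℝ i := by
    ext1 ω
    conv_lhs => rw [← (EuclideanSpace.basisFun (Fin d) ℝ).sum_repr' (X ω)]
    simp only [real_inner_comm]
  rw [hX]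
  exact integrable_finsetSum _ fun i _ =>
    (h _ ((EuclideanSpace.basisFun (Fin d) ℝ).norm_eq_one i)).smul_const _

/-- The infimum in `psi2Norm` is not shown to be attained, so `2 * τ` replaces `τ` to make the
inequality strict; the variance proxy is then `2 (2τ)² = 8τ²`. Other directions follow by
homogeneity. -/
theorem isSubgaussianVec_of_psi2NormVec_le [IsProbabilityMeasure P]
    {X : Ω → EuclideanSpace ℝ (Fin d)} {τ : ℝ} (hτ : 0 < τ) (hX : Measurable X)
    (h0 : ∫ ω, X ω ∂P = 0) (h : psi2NormVec P X ≤ ENNReal.ofReal τ) :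
    IsSubgaussianVec X (Real.toNNReal (8 * τ ^ 2)) P := by
  have hexp : ∀ u : EuclideanSpace ℝ (Fin d), ‖u‖ = 1 →
      ∫⁻ ω, ENNReal.ofReal (Real.exp (inner ℝ (X ω) u ^ 2 / (2 * τ) ^ 2)) ∂P ≤ 2 := by
    intro u hu
    refine lintegral_exp_sq_le_of_psi2Norm_lt (lt_of_le_of_lt
      ((le_iSup₂ (f := fun (u : EuclideanSpace ℝ (Fin d)) (_ : ‖u‖ = 1) =>
        psi2Norm P (fun ω => inner ℝ (X ω) u)) u hu).trans h) ?_)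
    rw [ENNReal.ofReal_lt_ofReal_iff (by positivity)]
    linarith
  have hmeas : ∀ u : EuclideanSpace ℝ (Fin d), Measurable fun ω => inner ℝ (X ω) u :=
    fun u => by fun_prop
  have hint : Integrable X P := integrable_of_forall_integrable_inner fun u hu =>
    integrable_of_integrable_exp_sq (K := 2 * τ) (by positivity) (hmeas u)
      (integrable_exp_sq_of_lintegral_le (hmeas u) (hexp u hu))
  have hunit : ∀ u : EuclideanSpace ℝ (Fin d), ‖u‖ = 1 →
      HasSubgaussianMGF (fun ω => inner ℝ (X ω) u) (Real.toNNReal (8 * τ ^ 2)) P := by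
    intro u hu
    have h1 : ∫ ω, inner ℝ (X ω) u ∂P = 0 := by
      simp_rw [real_inner_comm u]
      rw [integral_inner hint u, h0, inner_zero_right]
    have h2 := hasSubgaussianMGF_of_lintegral_exp_sq_le (K := 2 * τ) (by positivity) (hmeas u) h1
      (hexp u hu)
    convert! h2 using 2
    ring
  intro u
  rcases eq_or_ne u 0 with rfl | hu
  · simp
  · have hn : ‖u‖ ≠ 0 := norm_ne_zero_iff.mpr hu
    have h1 := hasSubgaussianMGF_const_mul (hunit (‖u‖⁻¹ • u) (by simp [norm_smul, hn])) ‖u‖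
    have h2 : ∀ ω, ‖u‖ * inner ℝ (X ω) (‖u‖⁻¹ • u) = inner ℝ (X ω) u := by
      intro ω
      rw [inner_smul_right]
      field_simp
    simp only [h2] at h1
    refine hasSubgaussianMGF_mono h1 (le_of_eq ?_)
    rw [mul_comm, nnnorm_norm]

theorem IsSubgaussianVec.sum_smul {n : ℕ} {g : Fin n → Ω → EuclideanSpace ℝ (Fin d)} {c : ℝ≥0}
    (hind : iIndepFun g P) (hg : ∀ i, IsSubgaussianVec (g i) c P) (v : EuclideanSpace ℝ (Fin n)) :
    IsSubgaussianVec (fun ω => ∑ i, v i • g i ω) (c * ‖v‖₊ ^ 2) P := by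
  intro u
  have h1 : iIndepFun (fun i ω => v i * inner ℝ (g i ω) u) P :=
    hind.comp (fun i x => v i * inner ℝ x u) (fun i => by fun_prop)
  have h2 := HasSubgaussianMGF.sum_of_iIndepFun h1 (s := Finset.univ)
    (fun i _ => hasSubgaussianMGF_const_mul (hg i u) (v i))
  have h3 : ∀ ω, inner ℝ (∑ i, v i • g i ω) u = ∑ i, v i * inner ℝ (g i ω) u := by
    intro ω
    simp [sum_inner, inner_smul_left]
  simp only [h3]
  refine hasSubgaussianMGF_mono h2 (le_of_eq ?_)
  rw [← Finset.sum_mul]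
  have h4 : ∑ i, ‖v i‖₊ ^ 2 = ‖v‖₊ ^ 2 := by
    refine NNReal.eq ?_
    push_cast
    rw [EuclideanSpace.norm_sq_eq]
  rw [h4]
  ring
end

/-! ### Nets and norm concentration -/

/-- The ball of radius `2` of a Euclidean space has a `1`-net with at most `5 ^ d` points. -/
theorem exists_net_closedBall_two (d : ℕ) : ∃ N : Finset (EuclideanSpace ℝ (Fin d)),
    N.card ≤ 5 ^ d ∧ (∀ c ∈ N, ‖c‖ ≤ 2) ∧
      ∀ x : EuclideanSpace ℝ (Fin d), ‖x‖ ≤ 2 → ∃ c ∈ N, ‖x - c‖ ≤ 1 := by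
  classical
  let S : ℕ → Prop := fun j => ∃ N : Finset (EuclideanSpace ℝ (Fin d)), N.card = j ∧
    (∀ c ∈ N, ‖c‖ ≤ 2) ∧ ∀ c ∈ N, ∀ e ∈ N, c ≠ e → 1 ≤ ‖c - e‖
  have hbd : ∀ N : Finset (EuclideanSpace ℝ (Fin d)), (∀ c ∈ N, ‖c‖ ≤ 2) →
      (∀ c ∈ N, ∀ e ∈ N, c ≠ e → 1 ≤ ‖c - e‖) → N.card ≤ 5 ^ d := by
    intro N h1 h2
    simpa using Besicovitch.card_le_of_separated N h1 h2
  have h0 : S 0 := ⟨∅, by simp⟩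
  -- A 1-separated set of maximal cardinality is a net; the bound `hbd` ensures that the search up
  -- to `5 ^ d` finds it.
  obtain ⟨N, hN, hN1, hN2⟩ : S (Nat.findGreatest S (5 ^ d)) :=
    Nat.findGreatest_spec (Nat.zero_le _) h0
  refine ⟨N, hbd N hN1 hN2, hN1, fun x hx => ?_⟩
  by_contra! hcon
  have hxN : x ∉ N := fun hxN => by have := hcon x hxN; simp at this; linarith
  have h1 : ∀ c ∈ insert x N, ‖c‖ ≤ 2 := by
    simp only [Finset.mem_insert, forall_eq_or_imp]
    exact ⟨hx, hN1⟩
  have h2 : ∀ c ∈ insert x N, ∀ e ∈ insert x N, c ≠ e → 1 ≤ ‖c - e‖ := by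
    intro c hc e he hce
    rcases Finset.mem_insert.mp hc with hcx | hc' <;> rcases Finset.mem_insert.mp he with hex | he'
    · exact absurd (hcx.trans hex.symm) hce
    · rw [hcx]; exact (hcon e he').le
    · rw [norm_sub_rev, hex]; exact (hcon c hc').le
    · exact hN2 c hc' e he' hce
  have h3 := Nat.le_findGreatest (hbd _ h1 h2) (show S _ from ⟨_, rfl, h1, h2⟩)
  rw [Finset.card_insert_of_notMem hxN] at h3
  omega

section

variable {Ω : Type*} [MeasurableSpace Ω] {P : Measure Ω} {d : ℕ}

/-- A net point `u` within 1 of `2 X / ‖X‖` satisfies `⟨X, u⟩ ≥ 2‖X‖ - ‖X‖ = ‖X‖`. A net of the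
radius 2 ball thus keeps the threshold `t` and only multiplies the proxy by 4. -/
theorem IsSubgaussianVec.measure_norm_ge_le [IsProbabilityMeasure P]
    {X : Ω → EuclideanSpace ℝ (Fin d)} {c : ℝ≥0}
    (h : IsSubgaussianVec X c P) {t : ℝ} (ht : 0 < t) :
    P.real {ω | t ≤ ‖X ω‖} ≤ 5 ^ d * Real.exp (-(t ^ 2 / (8 * c))) := by
  obtain ⟨N, hN, hN2, hnet⟩ := exists_net_closedBall_two d
  have hsub : {ω | t ≤ ‖X ω‖} ⊆ ⋃ u ∈ N, {ω | t ≤ inner ℝ (X ω) u} := by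
    intro ω hω
    have hω : t ≤ ‖X ω‖ := hω
    have hpos : 0 < ‖X ω‖ := ht.trans_le hω
    obtain ⟨u, hu, hd⟩ := hnet ((2 / ‖X ω‖) • X ω) (by
      rw [norm_smul, Real.norm_of_nonneg (by positivity)]
      field_simp; rfl)
    refine Set.mem_biUnion hu (hω.trans ?_)
    have h1 := real_inner_le_norm (X ω) ((2 / ‖X ω‖) • X ω - u)
    rw [inner_sub_right, inner_smul_right, real_inner_self_eq_norm_sq] at h1
    have h2 : 2 / ‖X ω‖ * ‖X ω‖ ^ 2 = 2 * ‖X ω‖ := by field_simp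
    nlinarith
  calc P.real {ω | t ≤ ‖X ω‖} ≤ P.real (⋃ u ∈ N, {ω | t ≤ inner ℝ (X ω) u}) :=
        measureReal_mono hsub (measure_ne_top _ _)
    _ ≤ ∑ u ∈ N, P.real {ω | t ≤ inner ℝ (X ω) u} := measureReal_biUnion_finset_le _ _
    _ ≤ ∑ u ∈ N, Real.exp (-(t ^ 2 / (8 * c))) := by
        refine Finset.sum_le_sum fun u hu => ?_
        have h1 := hasSubgaussianMGF_mono (c' := c * 4) (h u) (by
          have : ‖u‖₊ ≤ 2 := hN2 u hu
          calc c * ‖u‖₊ ^ 2 ≤ c * 2 ^ 2 := by gcongr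
            _ = c * 4 := by norm_num)
        refine (h1.measure_ge_le ht.le).trans_eq ?_
        push_cast
        rw [neg_div]
        congr 3; ring
    _ ≤ _ := by
        rw [Finset.sum_const, nsmul_eq_mul]
        gcongr
        exact_mod_cast hN

/-- The largest singular value of a matrix with independent sub-Gaussian rows. -/
theorem measure_opNorm_ge_le {n : ℕ} {g : Fin n → Ω → EuclideanSpace ℝ (Fin d)} {c : ℝ≥0}
    (hind : iIndepFun g P) (hm : ∀ i, Measurable (g i)) (hg : ∀ i, IsSubgaussianVec (g i) c P)
    {t : ℝ} (ht : 0 < t) :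
    ∃ E : Set Ω, MeasurableSet E ∧ P.real E ≤ 5 ^ n * (5 ^ d * Real.exp (-(t ^ 2 / (32 * c)))) ∧
      ∀ ω ∉ E, ∀ v : EuclideanSpace ℝ (Fin n), ‖∑ i, v i • g i ω‖ ≤ t * ‖v‖ := by
  have := hind.isProbabilityMeasure
  obtain ⟨N, hN, hN2, hnet⟩ := exists_net_closedBall_two n
  refine ⟨⋃ u ∈ N, {ω | t ≤ ‖∑ i, u i • g i ω‖}, ?_, ?_, ?_⟩
  · exact N.measurableSet_biUnion fun u _ => measurableSet_le measurable_const (by fun_prop)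
  · calc _ ≤ ∑ u ∈ N, P.real {ω | t ≤ ‖∑ i, u i • g i ω‖} := measureReal_biUnion_finset_le _ _
      _ ≤ ∑ u ∈ N, 5 ^ d * Real.exp (-(t ^ 2 / (32 * c))) := by
          refine Finset.sum_le_sum fun u hu => ?_
          have h1 : IsSubgaussianVec (fun ω => ∑ i, u i • g i ω) (c * 4) P := by
            refine fun w => hasSubgaussianMGF_mono (IsSubgaussianVec.sum_smul hind hg u w) ?_
            have : ‖u‖₊ ≤ 2 := hN2 u hu
            have h4 : ‖u‖₊ ^ 2 ≤ 4 := by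
              calc ‖u‖₊ ^ 2 ≤ 2 ^ 2 := by gcongr
                _ = 4 := by norm_num
            gcongr
          refine (h1.measure_norm_ge_le ht).trans_eq ?_
          push_cast
          congr 4; ring
      _ ≤ _ := by
          rw [Finset.sum_const, nsmul_eq_mul]
          gcongr
          exact_mod_cast hN
  · intro ω hω
    simp only [Set.mem_iUnion, Set.mem_ofPred_eq, not_exists, not_le] at hω
    let L : EuclideanSpace ℝ (Fin n) →ₗ[ℝ] EuclideanSpace ℝ (Fin d) :=
      { toFun := fun v => ∑ i, v i • g i ω
        map_add' := fun v w => by simp [add_smul, Finset.sum_add_distrib]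
        map_smul' := fun r v => by simp [mul_smul, Finset.smul_sum] }
    let T := L.toContinuousLinearMap
    have hT : ∀ v, T v = ∑ i, v i • g i ω := fun v => rfl
    -- Self-bounding: the distance to the net costs at most `‖T‖` at radius 2, and the inequality
    -- then forces `‖T‖ ≤ t`.
    have hle : ‖T‖ ≤ (t + ‖T‖) / 2 := by
      refine T.opNorm_le_bound (by positivity) fun x => ?_
      rcases eq_or_ne x 0 with rfl | hx
      · simp
      have hpos : 0 < ‖x‖ := norm_pos_iff.mpr hx
      obtain ⟨u, hu, hd⟩ := hnet ((2 / ‖x‖) • x) (by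
        rw [norm_smul, Real.norm_of_nonneg (by positivity)]
        field_simp; rfl)
      have h1 : ‖T ((2 / ‖x‖) • x)‖ ≤ t + ‖T‖ := by
        calc ‖T ((2 / ‖x‖) • x)‖ = ‖T u + T ((2 / ‖x‖) • x - u)‖ := by
              rw [← map_add]; simp
          _ ≤ ‖T u‖ + ‖T ((2 / ‖x‖) • x - u)‖ := norm_add_le _ _
          _ ≤ t + ‖T‖ * 1 := by
              gcongr
              · exact (hω u hu).le
              · exact (T.le_opNorm _).trans (by gcongr)
          _ = _ := by ring
      rw [map_smul, norm_smul, Real.norm_of_nonneg (by positivity)] at h1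
      have h2 : ‖T x‖ = 2 / ‖x‖ * ‖T x‖ * ‖x‖ / 2 := by field_simp
      have h3 := mul_le_mul_of_nonneg_right h1 hpos.le
      linarith
    intro v
    rw [← hT]
    refine (T.le_opNorm v).trans ?_
    gcongr
    linarith
end

/-! ### Inner products of independent sub-Gaussian vectors -/

section

variable {Ω : Type*} [MeasurableSpace Ω] {P : Measure Ω} {d : ℕ}

/-- If `S` is sub-Gaussian and independent of `X`, then conditionally on `X` the random variable
`⟨S, X⟩` is sub-Gaussian. -/
theorem lintegral_exp_inner_le_one [IsProbabilityMeasure P]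
    {X S : Ω → EuclideanSpace ℝ (Fin d)} {c : ℝ≥0}
    (hX : Measurable X) (hS : Measurable S) (hind : IndepFun S X P)
    (h : IsSubgaussianVec S c P) (l : ℝ) :
    ∫⁻ ω, ENNReal.ofReal (Real.exp (l * inner ℝ (S ω) (X ω) - l ^ 2 * c / 2 * ‖X ω‖ ^ 2)) ∂P
      ≤ 1 := by
  let F : EuclideanSpace ℝ (Fin d) × EuclideanSpace ℝ (Fin d) → ℝ≥0∞ := fun p =>
    ENNReal.ofReal (Real.exp (l * inner ℝ p.1 p.2 - l ^ 2 * c / 2 * ‖p.2‖ ^ 2))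
  have hF : Measurable F := by fun_prop
  have h1 : ∫⁻ ω, F (S ω, X ω) ∂P = ∫⁻ x, ∫⁻ s, F (s, x) ∂(P.map S) ∂(P.map X) := by
    rw [← lintegral_map (f := F) hF (hS.prodMk hX),
      (indepFun_iff_map_prod_eq_prod_map_map hS.aemeasurable hX.aemeasurable).mp hind,
      lintegral_prod_symm' _ hF]
  refine h1.trans_le ?_
  have := Measure.isProbabilityMeasure_map (μ := P) hX.aemeasurable
  calc ∫⁻ x, ∫⁻ s, F (s, x) ∂(P.map S) ∂(P.map X) ≤ ∫⁻ x, 1 ∂(P.map X) := by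
        refine lintegral_mono fun x => ?_
        rw [lintegral_map (by fun_prop) hS]
        have h2 := (h x).mgf_le l
        have h3 := (h x).integrable_exp_mul l
        have h4 : ∀ ω, F (S ω, x) = ENNReal.ofReal (Real.exp (l * inner ℝ (S ω) x)) *
            ENNReal.ofReal (Real.exp (-(l ^ 2 * c / 2 * ‖x‖ ^ 2))) := by
          intro ω
          rw [← ENNReal.ofReal_mul (Real.exp_pos _).le, ← Real.exp_add]
          rfl
        simp only [h4]
        rw [lintegral_mul_const _ (by fun_prop),
          ← ofReal_integral_eq_lintegral_ofReal h3 (ae_of_all _ fun _ => (Real.exp_pos _).le),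
          ← ENNReal.ofReal_mul (integral_nonneg fun _ => (Real.exp_pos _).le)]
        refine ENNReal.ofReal_le_one.mpr ?_
        calc _ ≤ Real.exp (((c * ‖x‖₊ ^ 2 : ℝ≥0) : ℝ) * l ^ 2 / 2) *
              Real.exp (-(l ^ 2 * c / 2 * ‖x‖ ^ 2)) := by
              gcongr
              exact h2
          _ = 1 := by
              rw [← Real.exp_add, Real.exp_eq_one_iff]
              push_cast
              ring
    _ = 1 := by simp

theorem measure_inner_ge_le [IsProbabilityMeasure P]
    {X S : Ω → EuclideanSpace ℝ (Fin d)} {c : ℝ≥0}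
    (hX : Measurable X) (hS : Measurable S) (hind : IndepFun S X P)
    (h : IsSubgaussianVec S c P) (l t : ℝ) :
    P.real {ω | t ≤ l * inner ℝ (S ω) (X ω) - l ^ 2 * c / 2 * ‖X ω‖ ^ 2} ≤ Real.exp (-t) := by
  have h1 := lintegral_exp_inner_le_one hX hS hind h l
  have h2 := meas_ge_le_lintegral_div (μ := P) (f := fun ω => ENNReal.ofReal
    (Real.exp (l * inner ℝ (S ω) (X ω) - l ^ 2 * c / 2 * ‖X ω‖ ^ 2))) (by fun_prop)
    (ε := ENNReal.ofReal (Real.exp t)) (by simp [Real.exp_pos]) (by simp)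
  refine ENNReal.toReal_le_of_le_ofReal (Real.exp_pos _).le ?_
  calc P {ω | t ≤ l * inner ℝ (S ω) (X ω) - l ^ 2 * c / 2 * ‖X ω‖ ^ 2}
      ≤ P {ω | ENNReal.ofReal (Real.exp t) ≤ ENNReal.ofReal
        (Real.exp (l * inner ℝ (S ω) (X ω) - l ^ 2 * c / 2 * ‖X ω‖ ^ 2))} := by
        refine measure_mono fun ω (hω : t ≤ _) => ?_
        exact ENNReal.ofReal_le_ofReal (Real.exp_le_exp.mpr hω)
    _ ≤ _ := h2
    _ ≤ 1 / ENNReal.ofReal (Real.exp t) := by gcongr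
    _ = _ := by
        rw [Real.exp_neg, ENNReal.ofReal_inv_of_pos (Real.exp_pos _), one_div]

/-- Two-sided bound for the inner product of independent vectors, on the event that the second
vector has norm at most `L`. -/
theorem measure_abs_inner_gt_le [IsProbabilityMeasure P]
    {X S : Ω → EuclideanSpace ℝ (Fin d)} {c : ℝ≥0}
    (hX : Measurable X) (hS : Measurable S) (hind : IndepFun S X P)
    (h : IsSubgaussianVec S c P) {L t : ℝ} (hc : 0 < c) (hL : 0 < L) (ht : 0 < t) :
    P.real {ω | ‖X ω‖ ≤ L ∧ Real.sqrt (2 * c * t) * L < |inner ℝ (S ω) (X ω)|}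
      ≤ 2 * Real.exp (-t) := by
  have hc' : (0 : ℝ) < c := hc
  set r := Real.sqrt (2 * c * t) with hr
  have hr2 : r ^ 2 = 2 * c * t := Real.sq_sqrt (by positivity)
  have hrpos : 0 < r := Real.sqrt_pos.mpr (by positivity)
  -- The optimal Chernoff parameter: the gain `l r L` is `2t` and the penalty `l² c L² / 2` is `t`.
  set l := r / (c * L) with hl
  have hlpos : 0 < l := by positivity
  have key : ∀ x y : ℝ, 0 ≤ y → y ≤ L → r * L < x → t ≤ l * x - l ^ 2 * c / 2 * y ^ 2 := by
    intro x y hy hyL hx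
    have h1 : l ^ 2 * c / 2 * y ^ 2 ≤ l ^ 2 * c / 2 * L ^ 2 := by gcongr
    have h2 : l ^ 2 * c / 2 * L ^ 2 = t := by
      rw [hl, div_pow, hr2]; field_simp
    have h3 : l * (r * L) ≤ l * x := by gcongr
    have h4 : l * (r * L) = 2 * t := by
      have : l * (r * L) = r ^ 2 / c := by rw [hl]; field_simp
      rw [this, hr2]; field_simp
    linarith
  calc _ ≤ P.real ({ω | t ≤ l * inner ℝ (S ω) (X ω) - l ^ 2 * c / 2 * ‖X ω‖ ^ 2} ∪
        {ω | t ≤ (-l) * inner ℝ (S ω) (X ω) - (-l) ^ 2 * c / 2 * ‖X ω‖ ^ 2}) := by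
        refine measureReal_mono (fun ω hω => ?_) (measure_ne_top _ _)
        rcases lt_abs.mp hω.2 with h1 | h1
        · exact Or.inl (key _ _ (norm_nonneg _) hω.1 h1)
        · refine Or.inr ((key _ _ (norm_nonneg _) hω.1 h1).trans_eq ?_)
          ring
    _ ≤ _ := measureReal_union_le _ _
    _ ≤ Real.exp (-t) + Real.exp (-t) := by
        gcongr <;> exact measure_inner_ge_le hX hS hind h _ _
    _ = _ := by ring
end

/-! ### The signal-noise interaction -/

section

variable {Ω : Type*} [MeasurableSpace Ω] {P : Measure Ω} {n k d : ℕ}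

/-- Chebyshev's inequality for a sum of independent variables with bounded second moments. -/
theorem measure_sum_ge_le_of_secondMoment_le (hn : 0 < n) {Z : Fin n → Ω → ℝ} {A : ℝ}
    (hA : 0 < A) (hind : iIndepFun Z P) (hZ : ∀ j, MemLp (Z j) 2 P)
    (h2 : ∀ j, ∫ ω, Z j ω ^ 2 ∂P ≤ A ^ 2) :
    P.real {ω | 2 * n * A ≤ ∑ j, Z j ω} ≤ 1 / n := by
  have := hind.isProbabilityMeasure
  have hvar : ∀ j, variance (Z j) P ≤ A ^ 2 := fun j =>
    (variance_le_expectation_sq (hZ j).aestronglyMeasurable).trans (h2 j)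
  have hmean : ∀ j, ∫ ω, Z j ω ∂P ≤ A := by
    intro j
    have h1 := variance_eq_sub (hZ j)
    have h3 := variance_nonneg (Z j) P
    have h4 := h2 j
    simp only [Pi.pow_apply] at h1
    exact le_of_abs_le (abs_le_of_sq_le_sq (by linarith) hA.le)
  have hsum : MemLp (fun ω => ∑ j, Z j ω) 2 P := memLp_finsetSum _ fun j _ => hZ j
  have hvs : variance (fun ω => ∑ j, Z j ω) P ≤ n * A ^ 2 := by
    have h1 := IndepFun.variance_sum (μ := P) (X := Z) (s := Finset.univ) (fun j _ => hZ j)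
      (fun i _ j _ hij => hind.indepFun hij)
    have h3 : (∑ j, Z j) = fun ω => ∑ j, Z j ω := by ext; simp
    rw [h3] at h1
    rw [h1]
    calc _ ≤ ∑ j : Fin n, A ^ 2 := Finset.sum_le_sum fun j _ => hvar j
      _ = _ := by simp
  have hms : ∫ ω, ∑ j, Z j ω ∂P ≤ n * A := by
    rw [integral_finsetSum _ fun j _ => (hZ j).integrable (by norm_num)]
    calc _ ≤ ∑ j : Fin n, A := Finset.sum_le_sum fun j _ => hmean j
      _ = _ := by simp
  have hn' : (0 : ℝ) < n := by exact_mod_cast hn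
  have hcheb := meas_ge_le_variance_div_sq hsum (c := n * A) (by positivity)
  refine ENNReal.toReal_le_of_le_ofReal (by positivity) ?_
  calc P {ω | 2 * n * A ≤ ∑ j, Z j ω}
      ≤ P {ω | n * A ≤ |∑ j, Z j ω - ∫ ω, ∑ j, Z j ω ∂P|} := by
        refine measure_mono fun ω (hω : 2 * n * A ≤ _) => ?_
        have h1 : n * A ≤ ∑ j, Z j ω - ∫ ω, ∑ j, Z j ω ∂P := by linarith
        exact h1.trans (le_abs_self _)
    _ ≤ _ := hcheb
    _ ≤ _ := by
        refine ENNReal.ofReal_le_ofReal ?_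
        rw [div_le_div_iff₀ (by positivity) hn']
        nlinarith

/-- The exponential bound for the noise of the point `j` in the directions that connect its
center to the other ones. -/
noncomputable def noiseExcess (τ : ℝ) (μ : Fin k → EuclideanSpace ℝ (Fin d)) (a : Fin k)
    (x : EuclideanSpace ℝ (Fin d)) : ℝ :=
  ∑ b ∈ Finset.univ.erase a,
    Real.exp (1 / (256 * τ ^ 2) * (inner ℝ x (μ b - μ a) - ‖μ b - μ a‖ ^ 2 / 16))

theorem minSep_le (μ : Fin k → EuclideanSpace ℝ (Fin d)) {a b : Fin k} (hab : a ≠ b) :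
    minSep μ ≤ ‖μ a - μ b‖ :=
  ciInf_le (Set.finite_range _).bddBelow (⟨(a, b), hab⟩ : {p : Fin k × Fin k // p.1 ≠ p.2})

theorem minSep_nonneg (μ : Fin k → EuclideanSpace ℝ (Fin d)) : 0 ≤ minSep μ :=
  Real.iInf_nonneg fun _ => norm_nonneg _

theorem measurable_noiseExcess (τ : ℝ) (μ : Fin k → EuclideanSpace ℝ (Fin d)) (a : Fin k) :
    Measurable (noiseExcess τ μ a) := by
  unfold noiseExcess
  fun_prop

/-- With `δ = ‖μ b - μ a‖`, squaring one exponential doubles its parameter to `1 / (128 τ²)`, the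
best choice for proxy `8τ² δ²`: the moment bound adds `δ² / (4096 τ²)` to the shift `-δ² / (2048
τ²)`. Cauchy-Schwarz over `b` supplies the factor `k`. -/
theorem integral_noiseExcess_sq_le [IsProbabilityMeasure P] {τ : ℝ} (hτ : 0 < τ)
    {X : Ω → EuclideanSpace ℝ (Fin d)} (hXm : Measurable X)
    (hX : IsSubgaussianVec X (Real.toNNReal (8 * τ ^ 2)) P)
    (μ : Fin k → EuclideanSpace ℝ (Fin d)) (a : Fin k) :
    MemLp (fun ω => noiseExcess τ μ a (X ω)) 2 P ∧
      ∫ ω, noiseExcess τ μ a (X ω) ^ 2 ∂P ≤ (k * Real.exp (-(snr μ τ ^ 2 / 8192))) ^ 2 := by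
  set T : Fin k → Ω → ℝ := fun b ω =>
    Real.exp (1 / (256 * τ ^ 2) * (inner ℝ (X ω) (μ b - μ a) - ‖μ b - μ a‖ ^ 2 / 16)) with hT
  have hTm : ∀ b, Measurable (T b) := fun b => by simp only [hT]; fun_prop
  have hTsq : ∀ b ω, T b ω ^ 2 = Real.exp (2 * (1 / (256 * τ ^ 2)) * inner ℝ (X ω) (μ b - μ a)) *
      Real.exp (-(‖μ b - μ a‖ ^ 2 / (2048 * τ ^ 2))) := by
    intro b ω
    simp only [hT]
    rw [← Real.exp_nat_mul, ← Real.exp_add]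
    congr 1
    push_cast
    field_simp
    ring
  have hTint : ∀ b, Integrable (fun ω => T b ω ^ 2) P := by
    intro b
    simp only [hTsq]
    exact ((hX _).integrable_exp_mul _).mul_const _
  have hTle : ∀ b, b ≠ a → ∫ ω, T b ω ^ 2 ∂P ≤ Real.exp (-(snr μ τ ^ 2 / 4096)) := by
    intro b hb
    simp only [hTsq]
    rw [integral_mul_const]
    refine (mul_le_mul_of_nonneg_right ((hX (μ b - μ a)).mgf_le _) (Real.exp_pos _).le).trans ?_
    rw [← Real.exp_add]
    refine Real.exp_le_exp.mpr ?_
    push_cast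
    rw [Real.coe_toNNReal _ (by positivity)]
    have h1 : snr μ τ ^ 2 ≤ ‖μ b - μ a‖ ^ 2 / τ ^ 2 := by
      unfold snr
      rw [div_pow]
      have := minSep_le μ hb
      have := minSep_nonneg μ
      gcongr
    have h2 : 8 * τ ^ 2 * ‖μ b - μ a‖ ^ 2 * (2 * (1 / (256 * τ ^ 2))) ^ 2 / 2 +
        -(‖μ b - μ a‖ ^ 2 / (2048 * τ ^ 2)) = -(‖μ b - μ a‖ ^ 2 / τ ^ 2 / 4096) := by
      field_simp
      ring
    rw [h2]
    linarith
  refine ⟨?_, ?_⟩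
  · refine memLp_finsetSum _ fun b _ => ?_
    exact (memLp_two_iff_integrable_sq (hTm b).aestronglyMeasurable).mpr (hTint b)
  · have hle : ∀ ω, noiseExcess τ μ a (X ω) ^ 2 ≤
        (k : ℝ) * ∑ b ∈ Finset.univ.erase a, T b ω ^ 2 := by
      intro ω
      refine (sq_sum_le_card_mul_sum_sq (s := Finset.univ.erase a) (f := fun b => T b ω)).trans ?_
      have hc : (((Finset.univ : Finset (Fin k)).erase a).card : ℝ) ≤ k := by
        have := Finset.card_erase_le (s := (Finset.univ : Finset (Fin k))) (a := a)
        simp only [Finset.card_univ, Fintype.card_fin] at this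
        exact_mod_cast this
      gcongr
    have hint : Integrable (fun ω => (k : ℝ) * ∑ b ∈ Finset.univ.erase a, T b ω ^ 2) P :=
      (integrable_finsetSum _ fun b _ => hTint b).const_mul _
    calc _ ≤ ∫ ω, (k : ℝ) * ∑ b ∈ Finset.univ.erase a, T b ω ^ 2 ∂P :=
          integral_mono_of_nonneg (ae_of_all _ fun ω => sq_nonneg _) hint (ae_of_all _ hle)
      _ = k * ∑ b ∈ Finset.univ.erase a, ∫ ω, T b ω ^ 2 ∂P := by
          rw [integral_const_mul, integral_finsetSum _ fun b _ => hTint b]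
      _ ≤ k * ∑ b ∈ (Finset.univ : Finset (Fin k)).erase a, Real.exp (-(snr μ τ ^ 2 / 4096)) := by
          gcongr with b hb
          exact hTle b (Finset.ne_of_mem_erase hb)
      _ ≤ k * ∑ b : Fin k, Real.exp (-(snr μ τ ^ 2 / 4096)) := by
          gcongr
          exact Finset.erase_subset _ _
      _ = _ := by
          rw [mul_pow, ← Real.exp_nat_mul]
          simp only [Finset.sum_const, Finset.card_univ, Fintype.card_fin, nsmul_eq_mul]
          push_cast
          rw [sq (k : ℝ), mul_assoc]
          congr 4; ring

theorem measure_sum_noiseExcess_ge_le (hn : 0 < n) (hk : 0 < k)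
    {τ : ℝ} (hτ : 0 < τ) {g : Fin n → Ω → EuclideanSpace ℝ (Fin d)}
    (hgm : ∀ i, Measurable (g i)) (hind : iIndepFun g P)
    (hg : ∀ i, IsSubgaussianVec (g i) (Real.toNNReal (8 * τ ^ 2)) P)
    (μ : Fin k → EuclideanSpace ℝ (Fin d)) (σ : Fin n → Fin k) :
    P.real {ω | 2 * n * (k * Real.exp (-(snr μ τ ^ 2 / 8192))) ≤
      ∑ j, noiseExcess τ μ (σ j) (g j ω)} ≤ 1 / n := by
  have := hind.isProbabilityMeasure
  have hk' : (0 : ℝ) < k := by exact_mod_cast hk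
  exact measure_sum_ge_le_of_secondMoment_le hn (by positivity)
    (hind.comp (fun j => noiseExcess τ μ (σ j)) fun j => measurable_noiseExcess τ μ (σ j))
    (fun j => (integral_noiseExcess_sq_le hτ (hgm j) (hg j) μ (σ j)).1)
    (fun j => (integral_noiseExcess_sq_le hτ (hgm j) (hg j) μ (σ j)).2)
end

open scoped MatrixOrder Matrix.Norms.L2Operator in
theorem Matrix.PosSemidef.exists_eq_conjTranspose_mul_self {n : ℕ} {Z : Matrix (Fin n) (Fin n) ℝ}
    (hZ : Z.PosSemidef) : ∃ B : Matrix (Fin n) (Fin n) ℝ, Z = Bᴴ * B :=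
  CStarAlgebra.nonneg_iff_eq_star_mul_self.mp hZ.nonneg

/-! ### Deterministic analysis of the semidefinite program -/

section

variable {n k d : ℕ}

/-- The indicator matrix of the relation of having the same label. -/
def clusterMatrix (σ : Fin n → Fin k) : Matrix (Fin n) (Fin n) ℝ :=
  Matrix.of fun i j => if σ i = σ j then 1 else 0

/-- The total weight that `Y` puts on pairs of points with different labels. -/
def offClusterMass (σ : Fin n → Fin k) (Y : Matrix (Fin n) (Fin n) ℝ) : ℝ :=
  ∑ i, ∑ j, if σ i = σ j then 0 else Y i j

/-- The Gram matrix of a family of vectors. -/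
noncomputable def gramMatrix (g : Fin n → EuclideanSpace ℝ (Fin d)) : Matrix (Fin n) (Fin n) ℝ :=
  Matrix.of fun i j => inner ℝ (g i) (g j)

/-- The sum of the entrywise products of two real matrices. -/
def frobInner (Y A : Matrix (Fin n) (Fin n) ℝ) : ℝ := ∑ i, ∑ j, Y i j * A i j

theorem trace_transpose_mul_eq_frobInner (Y A : Matrix (Fin n) (Fin n) ℝ) :
    (Yᵀ * A).trace = frobInner Y A := by
  simp only [Matrix.trace, Matrix.diag_apply, Matrix.mul_apply, Matrix.transpose_apply, frobInner]
  exact Finset.sum_comm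

theorem frobInner_sub_left (Y Z A : Matrix (Fin n) (Fin n) ℝ) :
    frobInner (Y - Z) A = frobInner Y A - frobInner Z A := by
  simp [frobInner, sub_mul, Finset.sum_sub_distrib]

theorem abs_frobInner_le {W M : Matrix (Fin n) (Fin n) ℝ} {B : ℝ} (hM : ∀ i j, |M i j| ≤ B) :
    |frobInner W M| ≤ B * ∑ i, ∑ j, |W i j| := by
  unfold frobInner
  refine (Finset.abs_sum_le_sum_abs _ _).trans ?_
  rw [Finset.mul_sum]
  refine Finset.sum_le_sum fun i _ => (Finset.abs_sum_le_sum_abs _ _).trans ?_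
  rw [Finset.mul_sum]
  refine Finset.sum_le_sum fun j _ => ?_
  rw [abs_mul, mul_comm]
  exact mul_le_mul_of_nonneg_right (hM i j) (abs_nonneg _)

theorem IsSDPFeasible.symm_apply {Y : Matrix (Fin n) (Fin n) ℝ} (h : IsSDPFeasible k Y)
    (i j : Fin n) : Y i j = Y j i := by
  have := h.psd.isHermitian.apply i j
  simpa using this.symm

theorem IsSDPFeasible.sum_row {Y : Matrix (Fin n) (Fin n) ℝ} (h : IsSDPFeasible k Y)
    (i : Fin n) : ∑ j, Y i j = (n : ℝ) / k := by
  have := congrFun h.row_sum i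
  simpa [Matrix.mulVec, dotProduct] using this

theorem IsSDPFeasible.sum_col {Y : Matrix (Fin n) (Fin n) ℝ} (h : IsSDPFeasible k Y)
    (j : Fin n) : ∑ i, Y i j = (n : ℝ) / k := by
  rw [← h.sum_row j]
  exact Finset.sum_congr rfl fun i _ => h.symm_apply i j

/-- Positive semidefiniteness tested on `e_i - e_j`, with unit diagonal. -/
theorem IsSDPFeasible.le_one {Y : Matrix (Fin n) (Fin n) ℝ} (h : IsSDPFeasible k Y)
    (i j : Fin n) : Y i j ≤ 1 := by
  rcases eq_or_ne i j with rfl | hij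
  · exact (h.diag i).le
  have h1 := h.psd.dotProduct_mulVec_nonneg (Pi.single i 1 - Pi.single j 1)
  have h2 := h.symm_apply i j
  have h3 := h.diag i
  have h4 := h.diag j
  simp [Matrix.mulVec_sub, sub_dotProduct, dotProduct_sub] at h1
  linarith

theorem clusterMatrix_symm (σ : Fin n → Fin k) (i j : Fin n) :
    clusterMatrix σ i j = clusterMatrix σ j i := by
  simp [clusterMatrix, eq_comm]

theorem isSDPFeasible_clusterMatrix {σ : Fin n → Fin k}
    (hbal : ∀ a, ((Finset.univ.filter (fun i => σ i = a)).card : ℝ) = (n : ℝ) / k) :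
    IsSDPFeasible k (clusterMatrix σ) where
  row_sum := by
    ext i
    rw [← hbal (σ i)]
    simp [Matrix.mulVec, dotProduct, clusterMatrix, eq_comm]
  psd := by
    have h1 : clusterMatrix σ =
        (Matrix.of fun (i : Fin n) (a : Fin k) => if σ i = a then (1 : ℝ) else 0) *
        (Matrix.of fun (i : Fin n) (a : Fin k) => if σ i = a then (1 : ℝ) else 0)ᴴ := by
      ext i j
      simp [clusterMatrix, Matrix.mul_apply, eq_comm]
    rw [h1]
    exact Matrix.posSemidef_self_mul_conjTranspose _
  diag i := by simp [clusterMatrix]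
  nonneg i j := by
    simp only [clusterMatrix, Matrix.of_apply]
    split_ifs <;> norm_num

/-- The difference is nonpositive within clusters and nonnegative across them, and each row sums to
zero, so both parts have the same mass. -/
theorem sum_abs_sub_clusterMatrix {σ : Fin n → Fin k}
    (hbal : ∀ a, ((Finset.univ.filter (fun i => σ i = a)).card : ℝ) = (n : ℝ) / k)
    {Y : Matrix (Fin n) (Fin n) ℝ} (h : IsSDPFeasible k Y) :
    ∑ i, ∑ j, |Y i j - clusterMatrix σ i j| = 2 * offClusterMass σ Y := by
  unfold offClusterMass
  rw [Finset.mul_sum]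
  refine Finset.sum_congr rfl fun i _ => ?_
  have h1 := h.sum_row i
  have h2 := (isSDPFeasible_clusterMatrix hbal).sum_row i
  have h3 : ∑ j, |Y i j - clusterMatrix σ i j| =
      ∑ j, (clusterMatrix σ i j - Y i j + 2 * (if σ i = σ j then 0 else Y i j)) := by
    refine Finset.sum_congr rfl fun j _ => ?_
    have h4 := h.le_one i j
    have h5 := h.nonneg i j
    simp only [clusterMatrix, Matrix.of_apply]
    split_ifs
    · rw [abs_of_nonpos (by linarith)]; ring
    · rw [abs_of_nonneg (by linarith)]; ring
  rw [h3, Finset.sum_add_distrib, Finset.sum_sub_distrib, h1, h2, Finset.mul_sum]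
  ring

/-- This allows discarding every term that depends on one index only, such as the squared norms in
`sqDistMatrix`. -/
theorem frobInner_eq_zero_of_add {W : Matrix (Fin n) (Fin n) ℝ} (hr : ∀ i, ∑ j, W i j = 0)
    (hc : ∀ j, ∑ i, W i j = 0) (f e : Fin n → ℝ) : ∑ i, ∑ j, W i j * (f i + e j) = 0 := by
  simp only [mul_add, Finset.sum_add_distrib]
  rw [Finset.sum_comm (f := fun i j => W i j * e j)]
  simp [← Finset.sum_mul, hr, hc]

/-- The optimality of `Y`, compared to the true clustering. -/
theorem IsSDPSolution.frobInner_gramMatrix_nonneg {σ : Fin n → Fin k}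
    (hbal : ∀ a, ((Finset.univ.filter (fun i => σ i = a)).card : ℝ) = (n : ℝ) / k)
    {h : Fin n → EuclideanSpace ℝ (Fin d)} {Y : Matrix (Fin n) (Fin n) ℝ}
    (hY : IsSDPSolution k h Y) : 0 ≤ frobInner (Y - clusterMatrix σ) (gramMatrix h) := by
  have hs := isSDPFeasible_clusterMatrix hbal
  have h1 := hY.2 _ hs
  rw [trace_transpose_mul_eq_frobInner, trace_transpose_mul_eq_frobInner, ← sub_nonpos,
    ← frobInner_sub_left] at h1
  have h2 := frobInner_eq_zero_of_add (W := Y - clusterMatrix σ)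
    (fun i => by simp [hY.1.sum_row, hs.sum_row]) (fun i => by simp [hY.1.sum_col, hs.sum_col])
    (fun i => ‖h i‖ ^ 2) (fun i => ‖h i‖ ^ 2)
  have h3 : frobInner (Y - clusterMatrix σ) (sqDistMatrix h) =
      0 - 2 * frobInner (Y - clusterMatrix σ) (gramMatrix h) := by
    rw [← h2]
    unfold frobInner
    simp only [Finset.mul_sum, ← Finset.sum_sub_distrib]
    refine Finset.sum_congr rfl fun i _ => Finset.sum_congr rfl fun j _ => ?_
    simp only [sqDistMatrix, gramMatrix, Matrix.of_apply, norm_sub_sq_real]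
    ring
  linarith

/-- Expansion of the optimality condition into the signal term, the signal-noise term and the
noise term. -/
theorem IsSDPSolution.basic_inequality {σ : Fin n → Fin k}
    (hbal : ∀ a, ((Finset.univ.filter (fun i => σ i = a)).card : ℝ) = (n : ℝ) / k)
    {μ : Fin k → EuclideanSpace ℝ (Fin d)} {g : Fin n → EuclideanSpace ℝ (Fin d)}
    {Y : Matrix (Fin n) (Fin n) ℝ} (hY : IsSDPSolution k (sgmmData μ σ g) Y) :
    (∑ i, ∑ j, Y i j * ‖μ (σ i) - μ (σ j)‖ ^ 2) / 2 ≤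
      2 * ∑ i, ∑ j, Y i j * inner ℝ (g j) (μ (σ i) - μ (σ j)) +
        frobInner (Y - clusterMatrix σ) (gramMatrix g) := by
  have hs := isSDPFeasible_clusterMatrix hbal
  have h1 := hY.frobInner_gramMatrix_nonneg hbal
  set W := Y - clusterMatrix σ with hW
  have hr : ∀ i, ∑ j, W i j = 0 := fun i => by simp [hW, hY.1.sum_row, hs.sum_row]
  have hc : ∀ i, ∑ j, W j i = 0 := fun i => by simp [hW, hY.1.sum_col, hs.sum_col]
  have hWs : ∀ i j, W i j = W j i := fun i j => by
    simp only [hW, Matrix.sub_apply, hY.1.symm_apply i j, clusterMatrix_symm σ i j]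
  have h2 := frobInner_eq_zero_of_add hr hc (fun i => ‖μ (σ i)‖ ^ 2 / 2)
    (fun i => ‖μ (σ i)‖ ^ 2 / 2 + 2 * inner ℝ (g i) (μ (σ i)))
  -- The weights vanish within clusters, where alone `Y` and `W` differ.
  have hYW : ∀ i j, Y i j * ‖μ (σ i) - μ (σ j)‖ ^ 2 = W i j * ‖μ (σ i) - μ (σ j)‖ ^ 2 := by
    intro i j
    simp only [hW, Matrix.sub_apply, clusterMatrix, Matrix.of_apply]
    split_ifs with hij <;> simp [hij]
  have hYW' : ∀ i j, Y i j * inner ℝ (g j) (μ (σ i) - μ (σ j)) =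
      W i j * inner ℝ (g j) (μ (σ i) - μ (σ j)) := by
    intro i j
    simp only [hW, Matrix.sub_apply, clusterMatrix, Matrix.of_apply]
    split_ifs with hij <;> simp [hij]
  simp only [hYW, hYW']
  -- By symmetry of `W` the two cross terms coincide, whence the factor 2 of the signal-noise term.
  have h3 : ∑ i, ∑ j, W i j * inner ℝ (g i) (μ (σ j)) =
      ∑ i, ∑ j, W i j * inner ℝ (g j) (μ (σ i)) := by
    rw [Finset.sum_comm]
    exact Finset.sum_congr rfl fun i _ => Finset.sum_congr rfl fun j _ => by rw [hWs]
  have h4 : 2 * ∑ i, ∑ j, W i j * inner ℝ (g j) (μ (σ i) - μ (σ j)) +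
      frobInner W (gramMatrix g) - (∑ i, ∑ j, W i j * ‖μ (σ i) - μ (σ j)‖ ^ 2) / 2 =
      frobInner W (gramMatrix (sgmmData μ σ g)) - (∑ i, ∑ j, W i j * (‖μ (σ i)‖ ^ 2 / 2 +
        (‖μ (σ j)‖ ^ 2 / 2 + 2 * inner ℝ (g j) (μ (σ j))))) +
      (∑ i, ∑ j, W i j * inner ℝ (g j) (μ (σ i)) - ∑ i, ∑ j, W i j * inner ℝ (g i) (μ (σ j))) := by
    unfold frobInner
    simp only [Finset.mul_sum, Finset.sum_div, ← Finset.sum_sub_distrib, ← Finset.sum_add_distrib]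
    refine Finset.sum_congr rfl fun i _ => Finset.sum_congr rfl fun j _ => ?_
    simp only [sgmmData, gramMatrix, Matrix.of_apply, norm_sub_sq_real, inner_add_left,
      inner_add_right, inner_sub_right]
    rw [real_inner_comm (g j) (μ (σ i))]
    ring
  rw [h2, h3] at h4
  linarith

/-- For a positive semidefinite matrix, the trace inner product with a Gram matrix is controlled
by the trace and the operator norm of the family of vectors. -/
theorem frobInner_gramMatrix_le_of_posSemidef {g : Fin n → EuclideanSpace ℝ (Fin d)} {t : ℝ}
    (ht : ∀ v : EuclideanSpace ℝ (Fin n), ‖∑ i, v i • g i‖ ≤ t * ‖v‖)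
    {Z : Matrix (Fin n) (Fin n) ℝ} (hZ : Z.PosSemidef) :
    frobInner Z (gramMatrix g) ≤ t ^ 2 * Z.trace := by
  obtain ⟨B, rfl⟩ := hZ.exists_eq_conjTranspose_mul_self
  have h1 : frobInner (Bᴴ * B) (gramMatrix g) = ∑ l, ‖∑ i, B l i • g i‖ ^ 2 := by
    have h2 : ∀ l, ‖∑ i, B l i • g i‖ ^ 2 = ∑ i, ∑ j, B l i * B l j * inner ℝ (g i) (g j) := by
      intro l
      rw [← real_inner_self_eq_norm_sq, sum_inner]
      simp only [inner_sum, inner_smul_left, inner_smul_right]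
      refine Finset.sum_congr rfl fun i _ => Finset.sum_congr rfl fun j _ => ?_
      simp
      ring
    simp only [h2]
    rw [Finset.sum_comm]
    refine Finset.sum_congr rfl fun i _ => ?_
    rw [Finset.sum_comm]
    refine Finset.sum_congr rfl fun j _ => ?_
    simp [Matrix.mul_apply, gramMatrix, Finset.sum_mul]
  have h3 : (Bᴴ * B).trace = ∑ l, ∑ i, B l i ^ 2 := by
    rw [Finset.sum_comm]
    simp [Matrix.trace, Matrix.mul_apply, sq]
  rw [h1, h3, Finset.mul_sum]
  refine Finset.sum_le_sum fun l _ => ?_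
  have h4 := ht (WithLp.toLp 2 (B l))
  have h5 : ‖(WithLp.toLp 2 (B l) : EuclideanSpace ℝ (Fin n))‖ ^ 2 = ∑ i, B l i ^ 2 := by
    simp [EuclideanSpace.norm_sq_eq]
  rw [← h5, ← mul_pow]
  exact pow_le_pow_left₀ (norm_nonneg _) h4 2

theorem frobInner_mul_left {P : Matrix (Fin n) (Fin n) ℝ} (hP : Pᵀ = P)
    (W M : Matrix (Fin n) (Fin n) ℝ) : frobInner (P * W) M = frobInner W (P * M) := by
  rw [← trace_transpose_mul_eq_frobInner, ← trace_transpose_mul_eq_frobInner,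
    Matrix.transpose_mul, hP, Matrix.mul_assoc]

theorem frobInner_mul_right {P : Matrix (Fin n) (Fin n) ℝ} (hP : Pᵀ = P)
    (W M : Matrix (Fin n) (Fin n) ℝ) : frobInner (W * P) M = frobInner W (M * P) := by
  rw [← trace_transpose_mul_eq_frobInner, ← trace_transpose_mul_eq_frobInner,
    Matrix.transpose_mul, hP, Matrix.trace_mul_comm, ← Matrix.mul_assoc, Matrix.trace_mul_comm]

/-- The contribution of the noise alone. -/
theorem frobInner_noise_le {σ : Fin n → Fin k} {m : ℝ} (hm : 0 < m) (hmk : (n : ℝ) / k = m)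
    (hbal : ∀ a, ((Finset.univ.filter (fun i => σ i = a)).card : ℝ) = (n : ℝ) / k)
    {g : Fin n → EuclideanSpace ℝ (Fin d)} {B t : ℝ}
    (hB : ∀ a j, |inner ℝ (∑ i ∈ Finset.univ.filter (fun i => σ i = a), g i) (g j)| ≤ m * B)
    (ht : ∀ v : EuclideanSpace ℝ (Fin n), ‖∑ i, v i • g i‖ ≤ t * ‖v‖)
    {Y : Matrix (Fin n) (Fin n) ℝ} (hY : IsSDPFeasible k Y) :
    frobInner (Y - clusterMatrix σ) (gramMatrix g) ≤
      (6 * B + t ^ 2 / m) * offClusterMass σ Y := by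
  have hs := isSDPFeasible_clusterMatrix hbal
  set S := clusterMatrix σ with hS
  set W := Y - S with hW
  set Γ := gramMatrix g with hΓ
  -- `J` averages over clusters: it is the orthogonal projection onto the cluster-constant vectors,
  -- and `Q = 1 - J` below is the complementary one.
  set J : Matrix (Fin n) (Fin n) ℝ := m⁻¹ • S with hJ
  have hΓt : Γᵀ = Γ := by
    ext i j
    exact real_inner_comm (g i) (g j)
  have hJt : Jᵀ = J := by
    ext i j
    simp only [hJ, hS, Matrix.transpose_apply, Matrix.smul_apply, clusterMatrix_symm σ i j]
  have hSS : J * S = S := by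
    ext i j
    simp only [hJ, Matrix.smul_apply, Matrix.mul_apply, smul_eq_mul]
    have h1 : ∀ l, S i l * S l j = S i l * S i j := by
      intro l
      simp only [hS, clusterMatrix, Matrix.of_apply]
      by_cases h : σ i = σ l <;> simp [h]
    calc ∑ l, m⁻¹ * S i l * S l j = m⁻¹ * ((∑ l, S i l) * S i j) := by
          simp only [Finset.sum_mul, Finset.mul_sum, ← h1, mul_assoc]
      _ = S i j := by
          rw [hs.sum_row, hmk]
          field_simp
  have hSJ : S * J = S := by
    rw [hJ, Matrix.mul_smul, ← Matrix.smul_mul, ← hJ, hSS]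
  have hJΓ : ∀ i j, |(J * Γ) i j| ≤ B := by
    intro i j
    have h1 : (J * Γ) i j =
        m⁻¹ * inner ℝ (∑ l ∈ Finset.univ.filter (fun l => σ l = σ i), g l) (g j) := by
      simp only [hJ, Matrix.smul_apply, Matrix.mul_apply, smul_eq_mul, sum_inner,
        Finset.sum_filter, Finset.mul_sum]
      refine Finset.sum_congr rfl fun l _ => ?_
      by_cases h : σ i = σ l
      · simp [hS, hΓ, clusterMatrix, gramMatrix, h]
      · simp [hS, hΓ, clusterMatrix, gramMatrix, h, Ne.symm h]
    rw [h1, abs_mul, abs_of_pos (inv_pos.mpr hm), inv_mul_le_iff₀ hm]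
    exact hB _ _
  have hΓJ : ∀ i j, |(Γ * J) i j| ≤ B := by
    intro i j
    have h1 : Γ * J = (J * Γ)ᵀ := by rw [Matrix.transpose_mul, hJt, hΓt]
    rw [h1]
    exact hJΓ j i
  have hJsum : ∀ j, ∑ l, J l j = 1 := by
    intro j
    simp only [hJ, Matrix.smul_apply, smul_eq_mul, ← Finset.mul_sum, hs.sum_col, hmk]
    field_simp
  have hJnn : ∀ i j, 0 ≤ J i j := fun i j => mul_nonneg (inv_nonneg.mpr hm.le) (hs.nonneg i j)
  have hJΓJ : ∀ i j, |(J * (Γ * J)) i j| ≤ B := by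
    intro i j
    rw [← Matrix.mul_assoc, Matrix.mul_apply]
    calc _ ≤ ∑ l, |(J * Γ) i l * J l j| := Finset.abs_sum_le_sum_abs _ _
      _ ≤ ∑ l, B * J l j := by
          refine Finset.sum_le_sum fun l _ => ?_
          rw [abs_mul, abs_of_nonneg (hJnn l j)]
          exact mul_le_mul_of_nonneg_right (hJΓ i l) (hJnn l j)
      _ = B := by rw [← Finset.mul_sum, hJsum, mul_one]
  have hl1 : ∑ i, ∑ j, |W i j| = 2 * offClusterMass σ Y := sum_abs_sub_clusterMatrix hbal hY
  set Q : Matrix (Fin n) (Fin n) ℝ := 1 - J with hQ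
  have hQt : Qᴴ = Q := by
    rw [Matrix.conjTranspose_eq_transpose_of_trivial, hQ, Matrix.transpose_sub, hJt,
      Matrix.transpose_one]
  -- Since `Q` annihilates `S`, compressing the indefinite `W` yields a positive semidefinite
  -- matrix.
  have hQW : Q * W * Q = Qᴴ * Y * Q := by
    have : Q * S = 0 := by rw [hQ, Matrix.sub_mul, hSS, Matrix.one_mul, sub_self]
    rw [hQt, hW, show Q * (Y - S) = Q * Y - Q * S from Matrix.mul_sub _ _ _, this, sub_zero]
  have hdec : W = Q * W * Q + J * W + W * J - J * (W * J) := by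
    rw [hQ]
    noncomm_ring
  have hfadd : ∀ A C : Matrix (Fin n) (Fin n) ℝ, frobInner (A + C) Γ =
      frobInner A Γ + frobInner C Γ := by
    intro A C
    simp [frobInner, add_mul, Finset.sum_add_distrib]
  -- Equal diagonals give `W` trace zero, so the trace is `-tr (W J)`, which the zero row sums turn
  -- into the off-cluster mass over `m`.
  have htr : (Q * W * Q).trace = offClusterMass σ Y / m := by
    have hJJ : J * J = J := by
      conv_lhs => rw [hJ]
      rw [Matrix.smul_mul, hSJ]
    have hQQ : Q * Q = Q := by
      have h1 : Q * Q = 1 - J - J + J * J := by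
        rw [hQ]
        noncomm_ring
      rw [h1, hJJ, hQ]
      abel
    have hW0 : W.trace = 0 := by
      simp [hW, Matrix.trace, hY.diag, hs.diag]
    have hWJ : (W * J).trace = -(offClusterMass σ Y / m) := by
      have h1 : ∀ i, ∑ j, W i j * S j i = -∑ j, if σ i = σ j then 0 else Y i j := by
        intro i
        have h2 : ∑ j, W i j = 0 := by simp [hW, hY.sum_row, hs.sum_row]
        rw [eq_neg_iff_add_eq_zero, ← Finset.sum_add_distrib]
        refine (Finset.sum_congr rfl fun j _ => ?_).trans h2
        simp only [hW, Matrix.sub_apply, hS, clusterMatrix, Matrix.of_apply]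
        by_cases h : σ i = σ j
        · simp only [h, if_true]
          ring
        · simp only [h, Ne.symm h, if_false]
          ring
      simp only [hJ, Matrix.mul_smul, Matrix.trace_smul, smul_eq_mul]
      simp only [Matrix.trace, Matrix.diag_apply, Matrix.mul_apply, h1, Finset.sum_neg_distrib]
      unfold offClusterMass
      ring
    rw [Matrix.mul_assoc, Matrix.trace_mul_comm, Matrix.mul_assoc, hQQ, hQ, Matrix.mul_sub,
      Matrix.trace_sub, hWJ, Matrix.mul_one, hW0]
    ring
  have h1 := (abs_le.mp (abs_frobInner_le (W := W) hJΓ)).2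
  have h2 := (abs_le.mp (abs_frobInner_le (W := W) hΓJ)).2
  have h3 := (abs_le.mp (abs_frobInner_le (W := W) hJΓJ)).1
  have h4 : frobInner (Q * W * Q) Γ ≤ t ^ 2 * (Q * W * Q).trace := by
    rw [hQW]
    exact frobInner_gramMatrix_le_of_posSemidef ht (hY.psd.conjTranspose_mul_mul_same Q)
  have h5 : frobInner W Γ = frobInner (Q * W * Q) Γ + frobInner W (J * Γ) + frobInner W (Γ * J)
      - frobInner W (J * (Γ * J)) := by
    conv_lhs => rw [hdec]
    rw [frobInner_sub_left, hfadd, hfadd, frobInner_mul_left hJt, frobInner_mul_right hJt,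
      frobInner_mul_left hJt, frobInner_mul_right hJt, Matrix.mul_assoc J]
  rw [hl1] at h1 h2 h3
  rw [htr] at h4
  rw [h5]
  -- Each of the three terms with `J` costs `B` times the entrywise `ℓ₁` norm of `W`, which is twice
  -- the off-cluster mass.
  have h6 : (6 * B + t ^ 2 / m) * offClusterMass σ Y =
      3 * (B * (2 * offClusterMass σ Y)) + t ^ 2 * (offClusterMass σ Y / m) := by ring
  rw [h6]
  linarith

/-- The bound on the misplaced mass in terms of the signal-noise interaction. -/
theorem IsSDPSolution.offClusterMass_le {σ : Fin n → Fin k} {m : ℝ} (hm : 0 < m)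
    (hmk : (n : ℝ) / k = m)
    (hbal : ∀ a, ((Finset.univ.filter (fun i => σ i = a)).card : ℝ) = (n : ℝ) / k)
    {μ : Fin k → EuclideanSpace ℝ (Fin d)} {g : Fin n → EuclideanSpace ℝ (Fin d)} {B t τ : ℝ}
    (hτ : 0 < τ)
    (hB : ∀ a j, |inner ℝ (∑ i ∈ Finset.univ.filter (fun i => σ i = a), g i) (g j)| ≤ m * B)
    (ht : ∀ v : EuclideanSpace ℝ (Fin n), ‖∑ i, v i • g i‖ ≤ t * ‖v‖)
    (hBt : 6 * B + t ^ 2 / m ≤ minSep μ ^ 2 / 8)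
    {Y : Matrix (Fin n) (Fin n) ℝ} (hY : IsSDPSolution k (sgmmData μ σ g) Y) :
    minSep μ ^ 2 * offClusterMass σ Y ≤
      2048 * τ ^ 2 * m * ∑ j, noiseExcess τ μ (σ j) (g j) := by
  have h1 := hY.basic_inequality hbal
  have h2 := frobInner_noise_le hm hmk hbal hB ht hY.1
  set D := ∑ i, ∑ j, Y i j * ‖μ (σ i) - μ (σ j)‖ ^ 2 with hD
  set R := offClusterMass σ Y with hR
  have hR0 : 0 ≤ R := Finset.sum_nonneg fun i _ => Finset.sum_nonneg fun j _ => by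
    split_ifs
    · exact le_rfl
    · exact hY.1.nonneg i j
  have hDR : minSep μ ^ 2 * R ≤ D := by
    simp only [hR, hD, offClusterMass, Finset.mul_sum]
    refine Finset.sum_le_sum fun i _ => Finset.sum_le_sum fun j _ => ?_
    split_ifs with hij
    · simp [hij]
    · rw [mul_comm]
      have h3 := minSep_le μ hij
      have h4 := minSep_nonneg μ
      have h5 := hY.1.nonneg i j
      gcongr
  have h3 : (6 * B + t ^ 2 / m) * R ≤ D / 8 := by
    calc _ ≤ minSep μ ^ 2 / 8 * R := by gcongr
      _ ≤ _ := by linarith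
  -- From `y ≤ exp y` at `y = x / (256 τ²)`; a single summand of `noiseExcess` already suffices, and
  -- the bound no longer depends on `i`.
  have hexc : ∀ i j, inner ℝ (g j) (μ (σ i) - μ (σ j)) - ‖μ (σ i) - μ (σ j)‖ ^ 2 / 16 ≤
      256 * τ ^ 2 * noiseExcess τ μ (σ j) (g j) := by
    intro i j
    have hpos : 0 ≤ noiseExcess τ μ (σ j) (g j) :=
      Finset.sum_nonneg fun _ _ => (Real.exp_pos _).le
    by_cases hij : σ i = σ j
    · simp only [hij, sub_self, inner_zero_right, norm_zero]
      norm_num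
      positivity
    · set x := inner ℝ (g j) (μ (σ i) - μ (σ j)) - ‖μ (σ i) - μ (σ j)‖ ^ 2 / 16 with hx
      have h4 : Real.exp (1 / (256 * τ ^ 2) * x) ≤ noiseExcess τ μ (σ j) (g j) :=
        Finset.single_le_sum (f := fun b => Real.exp (1 / (256 * τ ^ 2) *
          (inner ℝ (g j) (μ b - μ (σ j)) - ‖μ b - μ (σ j)‖ ^ 2 / 16)))
          (fun _ _ => (Real.exp_pos _).le) (Finset.mem_erase.mpr ⟨hij, Finset.mem_univ _⟩)
      have h5 := Real.add_one_le_exp (1 / (256 * τ ^ 2) * x)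
      have h6 : x = 256 * τ ^ 2 * (1 / (256 * τ ^ 2) * x) := by field_simp
      rw [h6]
      gcongr
      linarith
  have h4 : ∑ i, ∑ j, Y i j * inner ℝ (g j) (μ (σ i) - μ (σ j)) ≤
      D / 16 + 256 * τ ^ 2 * m * ∑ j, noiseExcess τ μ (σ j) (g j) := by
    calc _ ≤ ∑ i, ∑ j, Y i j * (‖μ (σ i) - μ (σ j)‖ ^ 2 / 16 +
          256 * τ ^ 2 * noiseExcess τ μ (σ j) (g j)) := by
          refine Finset.sum_le_sum fun i _ => Finset.sum_le_sum fun j _ => ?_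
          refine mul_le_mul_of_nonneg_left ?_ (hY.1.nonneg i j)
          have := hexc i j
          linarith
      _ = D / 16 + ∑ i, ∑ j, Y i j * (256 * τ ^ 2 * noiseExcess τ μ (σ j) (g j)) := by
          simp only [mul_add, Finset.sum_add_distrib, hD, Finset.sum_div, mul_div_assoc]
      _ = _ := by
          rw [Finset.sum_comm]
          simp only [← Finset.sum_mul, hY.1.sum_col, hmk]
          simp only [Finset.mul_sum]
          congr 1
          exact Finset.sum_congr rfl fun j _ => by ring
  -- `D / 2` minus `D / 8` from the signal-noise term and `D / 8` from the noise leaves `D / 4`,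
  -- hence `2048 = 4 · 2 · 256`.
  linarith

end

/-! ### Analysis of the rounding procedure -/

section

variable {n k : ℕ}

/-- The indices whose row of `Y` is far from the row of the true cluster matrix. -/
noncomputable def badRows (σ : Fin n → Fin k) (Y : Matrix (Fin n) (Fin n) ℝ) : Finset (Fin n) :=
  Finset.univ.filter fun i => (n : ℝ) / (8 * k) < ∑ j, |Y i j - clusterMatrix σ i j|

theorem card_badRows_mul_le {σ : Fin n → Fin k} {Y : Matrix (Fin n) (Fin n) ℝ} :
    ((badRows σ Y).card : ℝ) * ((n : ℝ) / (8 * k)) ≤ ∑ i, ∑ j, |Y i j - clusterMatrix σ i j| := by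
  calc _ = ∑ i ∈ badRows σ Y, (n : ℝ) / (8 * k) := by rw [Finset.sum_const, nsmul_eq_mul]
    _ ≤ ∑ i ∈ badRows σ Y, ∑ j, |Y i j - clusterMatrix σ i j| :=
        Finset.sum_le_sum fun i hi => (Finset.mem_filter.mp hi).2.le
    _ ≤ _ := Finset.sum_le_sum_of_subset_of_nonneg (Finset.subset_univ _)
        fun _ _ _ => Finset.sum_nonneg fun _ _ => abs_nonneg _

theorem sum_abs_sub_le_of_notMem_badRows {σ : Fin n → Fin k} {Y : Matrix (Fin n) (Fin n) ℝ}
    {i : Fin n} (hi : i ∉ badRows σ Y) :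
    ∑ j, |Y i j - clusterMatrix σ i j| ≤ (n : ℝ) / (8 * k) := by
  simpa [badRows] using hi

theorem sum_abs_row_sub_le_of_same_label {σ : Fin n → Fin k} {Y : Matrix (Fin n) (Fin n) ℝ}
    {i j : Fin n} (hi : i ∉ badRows σ Y) (hj : j ∉ badRows σ Y) (hij : σ i = σ j) :
    ∑ l, |Y i l - Y j l| ≤ (n : ℝ) / (4 * k) := by
  have h1 := sum_abs_sub_le_of_notMem_badRows hi
  have h2 := sum_abs_sub_le_of_notMem_badRows hj
  have h3 : ∑ l, |Y i l - Y j l| ≤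
      ∑ l, (|Y i l - clusterMatrix σ i l| + |Y j l - clusterMatrix σ j l|) := by
    refine Finset.sum_le_sum fun l _ => ?_
    have h4 : clusterMatrix σ i l = clusterMatrix σ j l := by
      simp only [clusterMatrix, Matrix.of_apply, hij]
    rw [h4, abs_sub_comm (Y j l)]
    exact abs_sub_le _ _ _
  rw [Finset.sum_add_distrib] at h3
  have h5 : (n : ℝ) / (4 * k) = n / (8 * k) + n / (8 * k) := by ring
  linarith

/-- Otherwise the true rows would be `2n / k` apart, while the path through `u` has length at most
`(1/8 + 1/4 + 1/4 + 1/8) n / k`. The center `u` itself may be a bad row. -/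
theorem same_label_of_sum_abs_row_sub_le {σ : Fin n → Fin k}
    (hbal : ∀ a, ((Finset.univ.filter (fun i => σ i = a)).card : ℝ) = (n : ℝ) / k)
    {Y : Matrix (Fin n) (Fin n) ℝ} {u i j : Fin n} (hi : i ∉ badRows σ Y) (hj : j ∉ badRows σ Y)
    (hui : ∑ l, |Y u l - Y i l| ≤ (n : ℝ) / (4 * k))
    (huj : ∑ l, |Y u l - Y j l| ≤ (n : ℝ) / (4 * k)) : σ i = σ j := by
  by_contra hij
  have h1 := sum_abs_sub_le_of_notMem_badRows hi
  have h2 := sum_abs_sub_le_of_notMem_badRows hj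
  have hs := isSDPFeasible_clusterMatrix hbal
  have h3 : ∑ l, |clusterMatrix σ i l - clusterMatrix σ j l| = (n : ℝ) / k + n / k := by
    have e1 := hs.sum_row i
    have e2 := hs.sum_row j
    trans ∑ l, clusterMatrix σ i l + ∑ l, clusterMatrix σ j l
    swap
    · rw [e1, e2]
    rw [← Finset.sum_add_distrib]
    refine Finset.sum_congr rfl fun l _ => ?_
    simp only [clusterMatrix, Matrix.of_apply]
    by_cases h : σ i = σ l
    · simp [h, show ¬ σ j = σ l from fun h' => hij (h.trans h'.symm)]
    · by_cases h' : σ j = σ l <;> simp [h, h']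
  have h4 : ∑ l, |clusterMatrix σ i l - clusterMatrix σ j l| ≤
      ∑ l, (|Y i l - clusterMatrix σ i l| + |Y u l - Y i l| + |Y u l - Y j l| +
        |Y j l - clusterMatrix σ j l|) := by
    refine Finset.sum_le_sum fun l _ => ?_
    have e : clusterMatrix σ i l - clusterMatrix σ j l = -(Y i l - clusterMatrix σ i l) +
        -(Y u l - Y i l) + (Y u l - Y j l) + (Y j l - clusterMatrix σ j l) := by ring
    rw [e]
    refine (abs_add_le _ _).trans (add_le_add ((abs_add_le _ _).trans (add_le_add
      ((abs_add_le _ _).trans ?_) le_rfl)) le_rfl)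
    rw [abs_neg, abs_neg]
  simp only [Finset.sum_add_distrib] at h4
  have hpos : (0 : ℝ) < n / k := by
    rw [← hbal (σ i)]
    exact_mod_cast Finset.card_pos.mpr ⟨i, by simp⟩
  have e1 : (n : ℝ) / (8 * k) = n / k / 8 := by ring
  have e2 : (n : ℝ) / (4 * k) = n / k / 4 := by ring
  rw [e1] at h1 h2
  rw [e2] at hui huj
  linarith

/-- An extracted set contains correctly represented points of at most one cluster. -/
theorem IsExtraction.exists_label {σ : Fin n → Fin k}
    (hbal : ∀ a, ((Finset.univ.filter (fun i => σ i = a)).card : ℝ) = (n : ℝ) / k)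
    {Y : Matrix (Fin n) (Fin n) ℝ} {V B : Finset (Fin n)} (h : IsExtraction k Y V B) :
    ∃ c, ∀ i ∈ B, i ∉ badRows σ Y → σ i = c := by
  obtain ⟨u, hu, -, hsub, -⟩ := h
  by_cases hex : ∃ i ∈ B, i ∉ badRows σ Y
  · obtain ⟨i, hi, hib⟩ := hex
    refine ⟨σ i, fun j hj hjb => ?_⟩
    exact same_label_of_sum_abs_row_sub_le hbal hjb hib (Finset.mem_filter.mp (hsub hj)).2
      (Finset.mem_filter.mp (hsub hi)).2
  · push Not at hex
    exact ⟨σ u, fun i hi hib => absurd (hex i hi) hib⟩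

theorem FirstStep.exists_label {σ : Fin n → Fin k}
    (hbal : ∀ a, ((Finset.univ.filter (fun i => σ i = a)).card : ℝ) = (n : ℝ) / k)
    {Y : Matrix (Fin n) (Fin n) ℝ} {V : Finset (Fin n)} {Bs : List (Finset (Fin n))}
    (h : FirstStep k Y V Bs) : ∀ B ∈ Bs, ∃ c, ∀ i ∈ B, i ∉ badRows σ Y → σ i = c := by
  induction h with
  | done => simp
  | extract V B Bs hB _ ih =>
    simp only [List.mem_cons, forall_eq_or_imp]
    exact ⟨hB.exists_label hbal, ih⟩

/-- A set extracted while some cluster is untouched is large. -/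
theorem IsExtraction.card_le_of_untouched {σ : Fin n → Fin k} {m : ℕ}
    (hbal : ∀ a, ((Finset.univ.filter (fun i => σ i = a)).card : ℝ) = (n : ℝ) / k)
    (hm : (m : ℝ) = (n : ℝ) / k)
    {Y : Matrix (Fin n) (Fin n) ℝ} {V B : Finset (Fin n)} (h : IsExtraction k Y V B) {a : Fin k}
    (ha : ∀ i ∉ badRows σ Y, σ i = a → i ∈ V) : m ≤ B.card + (badRows σ Y).card := by
  obtain ⟨u, -, hmax, -, hcard⟩ := h
  have hcl : (Finset.univ.filter (fun i => σ i = a)).card = m := by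
    exact_mod_cast (hbal a).trans hm.symm
  have hgood : m ≤ (Finset.univ.filter (fun i => σ i = a) \ badRows σ Y).card +
      (badRows σ Y).card := by
    rw [← hcl]
    have := Finset.le_card_sdiff (badRows σ Y) (Finset.univ.filter (fun i => σ i = a))
    omega
  -- The largest ball is at least as large as the ball around any good point of `a`, which contains
  -- all good points of `a`.
  have hball : (Finset.univ.filter (fun i => σ i = a) \ badRows σ Y).card ≤
      (rowBall k Y V u).card := by
    rcases (Finset.univ.filter (fun i => σ i = a) \ badRows σ Y).eq_empty_or_nonempty with
      h0 | ⟨v, hv⟩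
    · rw [h0]; simp
    · simp only [Finset.mem_sdiff, Finset.mem_filter, Finset.mem_univ, true_and] at hv
      refine le_trans (Finset.card_le_card fun i hi => ?_) (hmax v (ha v hv.2 hv.1))
      simp only [Finset.mem_sdiff, Finset.mem_filter, Finset.mem_univ, true_and] at hi
      exact Finset.mem_filter.mpr ⟨ha i hi.2 hi.1,
        sum_abs_row_sub_le_of_same_label hv.2 hi.2 (hv.1.trans hi.1.symm)⟩
  rw [← hm] at hcard
  have hcard' : B.card = min (rowBall k Y V u).card m := by exact_mod_cast hcard
  rw [hcard']
  omega

/-- The first step outputs at least as many large sets as there are untouched clusters. -/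
theorem FirstStep.card_le_card_large {σ : Fin n → Fin k} {m : ℕ}
    (hbal : ∀ a, ((Finset.univ.filter (fun i => σ i = a)).card : ℝ) = (n : ℝ) / k)
    (hm : (m : ℝ) = (n : ℝ) / k)
    {Y : Matrix (Fin n) (Fin n) ℝ} {V : Finset (Fin n)} {Bs : List (Finset (Fin n))}
    (h : FirstStep k Y V Bs) : ∀ T : Finset (Fin k),
      (∀ a ∈ T, ∃ i ∉ badRows σ Y, σ i = a) →
      (∀ a ∈ T, ∀ i ∉ badRows σ Y, σ i = a → i ∈ V) →
      T.card ≤ (Finset.univ.filter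
        (fun s : Fin Bs.length => m ≤ (Bs.get s).card + (badRows σ Y).card)).card := by
  induction h with
  | done =>
    intro T hT1 hT2
    have : T = ∅ := by
      refine Finset.eq_empty_of_forall_notMem fun a ha => ?_
      obtain ⟨i, hi, hia⟩ := hT1 a ha
      exact absurd (hT2 a ha i hi hia) (Finset.notMem_empty i)
    simp [this]
  | extract V B Bs hB _ ih =>
    intro T hT1 hT2
    rcases T.eq_empty_or_nonempty with rfl | ⟨a, ha⟩
    · simp
    have hbig := hB.card_le_of_untouched hbal hm (hT2 a ha)
    obtain ⟨c, hc⟩ := hB.exists_label hbal (σ := σ)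
    -- An extraction removes good points of the cluster `c` only, so all other clusters of `T` stay
    -- untouched.
    have h1 := ih (T.erase c) (fun a ha => hT1 a (Finset.mem_of_mem_erase ha)) (by
      intro a ha i hi hia
      refine Finset.mem_sdiff.mpr ⟨hT2 a (Finset.mem_of_mem_erase ha) i hi hia, fun hiB => ?_⟩
      exact Finset.ne_of_mem_erase ha (hia.symm.trans (hc i hiB hi)))
    have h2 := Finset.pred_card_le_card_erase (s := T) (a := c)
    have h3 : (Finset.univ.filter (fun s : Fin (B :: Bs).length =>
        m ≤ ((B :: Bs).get s).card + (badRows σ Y).card)).card = (Finset.univ.filter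
        (fun s : Fin Bs.length => m ≤ (Bs.get s).card + (badRows σ Y).card)).card + 1 := by
      refine (Fin.card_filter_univ_succ _).trans ?_
      exact if_pos (show m ≤ ((B :: Bs).get 0).card + (badRows σ Y).card from hbig)
    rw [h3]
    omega

/-- Each estimated cluster contains few points outside of a suitable true cluster. -/
theorem IsClusterOutput.exists_card_le {σ : Fin n → Fin k} {m : ℕ}
    (hbal : ∀ a, ((Finset.univ.filter (fun i => σ i = a)).card : ℝ) = (n : ℝ) / k)
    (hm : (m : ℝ) = (n : ℝ) / k)
    {Y : Matrix (Fin n) (Fin n) ℝ} {σ' : Fin n → Fin k} (h : IsClusterOutput Y σ') (t : Fin k) :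
    ∃ c, (Finset.univ.filter (fun i => σ' i = t ∧ σ i ≠ c)).card ≤ 2 * (badRows σ Y).card := by
  obtain ⟨Bs, hfirst, e, hlarge, hlab, hsize⟩ := h
  have hclass : ∀ a, (Finset.univ.filter (fun i => σ i = a)).card = m := fun a => by
    exact_mod_cast (hbal a).trans hm.symm
  have hU : (Finset.univ.filter (fun i => σ' i = t)).card = m := by
    exact_mod_cast (hsize t).trans hm.symm
  set b := (badRows σ Y).card with hb
  -- With at least `m` bad rows the bound is trivial and any `c` serves.
  rcases le_or_gt m b with hmb | hmb
  · refine ⟨t, ?_⟩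
    have : (Finset.univ.filter (fun i => σ' i = t ∧ σ i ≠ t)).card ≤ m := by
      rw [← hU]
      exact Finset.card_le_card fun i hi => by simp_all
    omega
  have hgood : ∀ a, ∃ i ∉ badRows σ Y, σ i = a := by
    intro a
    obtain ⟨i, hi, hib⟩ := Finset.exists_mem_notMem_of_card_lt_card
      (show (badRows σ Y).card < (Finset.univ.filter (fun i => σ i = a)).card by
        rw [hclass]; exact hmb)
    exact ⟨i, hib, (Finset.mem_filter.mp hi).2⟩
  have hcount := hfirst.card_le_card_large hbal hm Finset.univ (fun a _ => hgood a)
    (fun _ _ i _ _ => Finset.mem_univ i)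
  rw [Finset.card_univ, Fintype.card_fin, ← hb] at hcount
  have hbig : m ≤ (Bs.get (e t)).card + b := by
    by_contra hcon
    -- If the set chosen for `t` were small, the at least `k` large sets would all be among the
    -- other `k - 1` chosen ones.
    have hsub : (Finset.univ.filter (fun s : Fin Bs.length => m ≤ (Bs.get s).card + b)) ⊆
        (Finset.univ.erase t).map e := by
      intro s hs
      have hs' := (Finset.mem_filter.mp hs).2
      by_cases hr : s ∈ Set.range e
      · obtain ⟨a, rfl⟩ := hr
        refine Finset.mem_map_of_mem e (Finset.mem_erase.mpr ⟨?_, Finset.mem_univ _⟩)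
        rintro rfl
        exact hcon hs'
      · have := hlarge s hr t
        omega
    have h1 := Finset.card_le_card hsub
    rw [Finset.card_map, Finset.card_erase_of_mem (Finset.mem_univ t), Finset.card_univ,
      Fintype.card_fin] at h1
    have := t.pos
    omega
  obtain ⟨c, hc⟩ := hfirst.exists_label hbal _ (Bs.get_mem (e t))
  refine ⟨c, ?_⟩
  have hBU : Bs.get (e t) ⊆ Finset.univ.filter (fun i => σ' i = t) := fun i hi =>
    Finset.mem_filter.mpr ⟨Finset.mem_univ i, hlab t i hi⟩
  -- A misplaced point was either added in the second step or is a bad row; there are at most `b` of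
  -- each kind.
  have hsub : Finset.univ.filter (fun i => σ' i = t ∧ σ i ≠ c) ⊆
      (Finset.univ.filter (fun i => σ' i = t) \ Bs.get (e t)) ∪ badRows σ Y := by
    intro i hi
    have hi' := (Finset.mem_filter.mp hi).2
    rw [Finset.mem_union, Finset.mem_sdiff]
    by_cases hib : i ∈ badRows σ Y
    · exact Or.inr hib
    · exact Or.inl ⟨Finset.mem_filter.mpr ⟨Finset.mem_univ i, hi'.1⟩,
        fun hiB => hi'.2 (hc i hiB hib)⟩
  have h1 := (Finset.card_le_card hsub).trans (Finset.card_union_le _ _)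
  rw [Finset.card_sdiff_of_subset hBU, hU] at h1
  omega

end

/-! ### The noise event and the error of the centers -/

section

variable {n k d : ℕ}

theorem five_pow_le_exp (d : ℕ) : (5 : ℝ) ^ d ≤ Real.exp (2 * d) := by
  have h : (5 : ℝ) ≤ Real.exp 2 := by
    have := Real.exp_one_gt_d9
    have h2 : Real.exp 2 = Real.exp 1 ^ 2 := by rw [← Real.exp_nat_mul]; norm_num
    rw [h2]
    nlinarith
  calc (5 : ℝ) ^ d ≤ Real.exp 2 ^ d := by gcongr
    _ = _ := by rw [← Real.exp_nat_mul]; ring_nf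

theorem exp_neg_nat_mul_log (hn : 0 < n) (j : ℕ) :
    Real.exp (-(j * Real.log n)) = 1 / (n : ℝ) ^ j := by
  rw [Real.exp_neg, Real.exp_nat_mul, Real.exp_log (by exact_mod_cast hn), one_div]

variable {Ω : Type*} [MeasurableSpace Ω] {P : Measure Ω}

/-- The constant 14 makes the exponent `14² / 64 = 49 / 16` times `d + log n`, which beats both `2d`
from the net and `3 log n`. -/
theorem IsSubgaussianVec.measure_norm_ge_le_inv_pow [IsProbabilityMeasure P] {r : ℝ≥0} (hr : 0 < r)
    {τ : ℝ} (hτ : 0 < τ) (hn : 4 ≤ n)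
    {X : Ω → EuclideanSpace ℝ (Fin d)} (hX : IsSubgaussianVec X (Real.toNNReal (8 * τ ^ 2) * r) P) :
    P.real {ω | Real.sqrt r * (14 * τ * Real.sqrt (d + Real.log n)) ≤ ‖X ω‖} ≤ 1 / (n : ℝ) ^ 3 := by
  have hlog : 0 < Real.log n := Real.log_pos (by exact_mod_cast (by omega : 1 < n))
  have hr' : (0 : ℝ) < r := hr
  have hsr : 0 < Real.sqrt r := Real.sqrt_pos.mpr hr'
  have hΛ : (0 : ℝ) < d + Real.log n := by positivity
  have hsΛ := Real.sqrt_pos.mpr hΛ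
  refine (hX.measure_norm_ge_le (by positivity)).trans ?_
  rw [← exp_neg_nat_mul_log (by omega)]
  refine (mul_le_mul_of_nonneg_right (five_pow_le_exp d) (Real.exp_pos _).le).trans ?_
  rw [← Real.exp_add]
  refine Real.exp_le_exp.mpr ?_
  push_cast
  rw [Real.coe_toNNReal _ (by positivity), mul_pow, mul_pow, Real.sq_sqrt hr'.le,
    Real.sq_sqrt hΛ.le]
  have : (r : ℝ) * ((14 * τ) ^ 2 * (d + Real.log n)) / (8 * (8 * τ ^ 2 * r)) =
      49 / 16 * (d + Real.log n) := by
    field_simp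
    norm_num
  rw [this]
  have : (0 : ℝ) ≤ d := by positivity
  linarith

/-- The sum of the vectors with indices in a finite set of at most `m` elements. -/
theorem IsSubgaussianVec.sum_finset {g : Fin n → Ω → EuclideanSpace ℝ (Fin d)} {c : ℝ≥0}
    (hind : iIndepFun g P) (hg : ∀ i, IsSubgaussianVec (g i) c P) {s : Finset (Fin n)} {m : ℕ}
    (hs : s.card ≤ m) : IsSubgaussianVec (fun ω => ∑ i ∈ s, g i ω) (c * m) P := by
  classical
  intro u
  have h1 := IsSubgaussianVec.sum_smul hind hg
    (WithLp.toLp 2 (fun i => if i ∈ s then (1 : ℝ) else 0)) u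
  simp only [ite_smul, one_smul, zero_smul, Finset.sum_ite_mem, Finset.univ_inter] at h1
  refine hasSubgaussianMGF_mono h1 ?_
  have h2 : ‖(WithLp.toLp 2 (fun i => if i ∈ s then (1 : ℝ) else 0) :
      EuclideanSpace ℝ (Fin n))‖₊ ^ 2 ≤ (m : ℝ≥0) := by
    rw [← NNReal.coe_le_coe]
    push_cast
    rw [EuclideanSpace.norm_sq_eq]
    simpa [apply_ite] using hs
  gcongr

/-- Concentration of all the quantities through which the noise enters the analysis. -/
theorem exists_noise_event {m : ℕ} (hn : 4 ≤ n) (hm : 0 < m) (hmk : m * k = n)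
    {τ : ℝ} (hτ : 0 < τ) {g : Fin n → Ω → EuclideanSpace ℝ (Fin d)}
    (hgm : ∀ i, Measurable (g i)) (hind : iIndepFun g P)
    (hg : ∀ i, IsSubgaussianVec (g i) (Real.toNNReal (8 * τ ^ 2)) P)
    (μ : Fin k → EuclideanSpace ℝ (Fin d)) (σ : Fin n → Fin k)
    (hσ : ∀ a, (Finset.univ.filter (fun i => σ i = a)).card = m) :
    ∃ E : Set Ω, MeasurableSet E ∧ 1 - 4 / (n : ℝ) ≤ P.real E ∧ ∀ ω ∈ E,
      (∑ j, noiseExcess τ μ (σ j) (g j ω) ≤ 2 * n * (k * Real.exp (-(snr μ τ ^ 2 / 8192)))) ∧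
      (∀ v : EuclideanSpace ℝ (Fin n), ‖∑ i, v i • g i ω‖ ≤ 28 * τ * Real.sqrt (n + d) * ‖v‖) ∧
      (∀ i, ‖g i ω‖ ≤ 14 * τ * Real.sqrt (d + Real.log n)) ∧
      (∀ a, ‖∑ i ∈ Finset.univ.filter (fun i => σ i = a), g i ω‖ ≤
        Real.sqrt m * (14 * τ * Real.sqrt (d + Real.log n))) ∧
      (∀ a j, |inner ℝ (∑ i ∈ Finset.univ.filter (fun i => σ i = a), g i ω) (g j ω)| ≤
        112 * τ ^ 2 * Real.sqrt (m * Real.log n * (d + Real.log n)) +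
          196 * τ ^ 2 * (d + Real.log n)) := by
  classical
  have := hind.isProbabilityMeasure
  have hk : 0 < k := Nat.pos_of_ne_zero (by rintro rfl; omega)
  have hkn : k ≤ n := by rw [← hmk]; exact Nat.le_mul_of_pos_left k hm
  have hn0 : 0 < n := by omega
  have hn' : (4 : ℝ) ≤ n := by exact_mod_cast hn
  have hkn' : (k : ℝ) ≤ n := by exact_mod_cast hkn
  have hm' : (0 : ℝ) < m := by exact_mod_cast hm
  have hlog : 0 < Real.log n := Real.log_pos (by linarith)
  have hΛ : (0 : ℝ) < d + Real.log n := by positivity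
  have hsΛ := Real.sqrt_pos.mpr hΛ
  set L := 14 * τ * Real.sqrt (d + Real.log n) with hL
  have hLpos : 0 < L := by positivity
  let F1 : Set Ω := {ω | 2 * n * (k * Real.exp (-(snr μ τ ^ 2 / 8192))) ≤
    ∑ j, noiseExcess τ μ (σ j) (g j ω)}
  have hF1m : MeasurableSet F1 := measurableSet_le measurable_const
    (Finset.measurable_sum _ fun j _ => (measurable_noiseExcess τ μ (σ j)).comp (hgm j))
  have hF1 : P.real F1 ≤ 1 / n := measure_sum_noiseExcess_ge_le hn0 hk hτ hgm hind hg μ σ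
  obtain ⟨F2, hF2m, hF2, hF2v⟩ := measure_opNorm_ge_le hind hgm hg
    (t := 28 * τ * Real.sqrt (n + d)) (by positivity)
  replace hF2 : P.real F2 ≤ 1 / n := by
    refine hF2.trans ?_
    rw [mul_pow, Real.sq_sqrt (by positivity), Real.coe_toNNReal _ (by positivity)]
    have h1 : (28 * τ) ^ 2 * ((n : ℝ) + d) / (32 * (8 * τ ^ 2)) = 49 / 16 * (n + d) := by
      field_simp
      norm_num
    rw [h1]
    calc _ ≤ Real.exp (2 * n) * (Real.exp (2 * d) * Real.exp (-(49 / 16 * (n + d)))) := by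
          gcongr
          · exact five_pow_le_exp n
          · exact five_pow_le_exp d
      _ = Real.exp (2 * n + (2 * d + -(49 / 16 * (n + d)))) := by
          rw [Real.exp_add, Real.exp_add]
      _ ≤ Real.exp (-(1 : ℕ) * Real.log n) := by
          refine Real.exp_le_exp.mpr ?_
          have h2 := Real.log_le_sub_one_of_pos (show (0 : ℝ) < n by linarith)
          have : (0 : ℝ) ≤ d := by positivity
          push_cast
          linarith
      _ = _ := by rw [neg_mul, exp_neg_nat_mul_log hn0, pow_one]
  let F3 : Set Ω := ⋃ i ∈ (Finset.univ : Finset (Fin n)), {ω | L ≤ ‖g i ω‖}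
  have hF3m : MeasurableSet F3 := Finset.measurableSet_biUnion _ fun i _ =>
    measurableSet_le measurable_const (hgm i).norm
  have hF3 : P.real F3 ≤ n * (1 / (n : ℝ) ^ 3) := by
    refine (measureReal_biUnion_finset_le _ _).trans ?_
    calc _ ≤ ∑ i : Fin n, 1 / (n : ℝ) ^ 3 := by
          refine Finset.sum_le_sum fun i _ => ?_
          have h1 := IsSubgaussianVec.measure_norm_ge_le_inv_pow (r := 1) one_pos hτ hn
            (X := g i) (by simpa using hg i)
          simpa using h1
      _ = _ := by simp
  let F4 : Set Ω := ⋃ a ∈ (Finset.univ : Finset (Fin k)),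
    {ω | Real.sqrt m * L ≤ ‖∑ i ∈ Finset.univ.filter (fun i => σ i = a), g i ω‖}
  have hF4m : MeasurableSet F4 := Finset.measurableSet_biUnion _ fun a _ =>
    measurableSet_le measurable_const (by fun_prop)
  have hF4 : P.real F4 ≤ k * (1 / (n : ℝ) ^ 3) := by
    refine (measureReal_biUnion_finset_le _ _).trans ?_
    calc _ ≤ ∑ a : Fin k, 1 / (n : ℝ) ^ 3 := by
          refine Finset.sum_le_sum fun a _ => ?_
          have h1 := IsSubgaussianVec.measure_norm_ge_le_inv_pow (r := m) (by exact_mod_cast hm)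
            hτ hn (IsSubgaussianVec.sum_finset hind hg (hσ a).le)
          simpa using h1
      _ = _ := by simp
  -- Leaving out `j` makes the cluster sum independent of `g j`; the omitted `‖g j‖²` is restored at
  -- the end through the norm bound.
  let S : Fin k → Fin n → Ω → EuclideanSpace ℝ (Fin d) := fun a j ω =>
    ∑ i ∈ (Finset.univ.filter (fun i => σ i = a)).erase j, g i ω
  let F5 : Set Ω := ⋃ p ∈ (Finset.univ : Finset (Fin k × Fin n)), {ω | ‖g p.2 ω‖ ≤ L ∧
    Real.sqrt (2 * (Real.toNNReal (8 * τ ^ 2) * m : ℝ≥0) * ((4 : ℕ) * Real.log n)) * L <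
      |inner ℝ (S p.1 p.2 ω) (g p.2 ω)|}
  have hSm : ∀ a j, Measurable (S a j) := fun a j => by fun_prop
  have hF5m : MeasurableSet F5 := Finset.measurableSet_biUnion _ fun p _ =>
    (measurableSet_le (hgm _).norm measurable_const).inter (measurableSet_lt measurable_const
      ((hSm p.1 p.2).inner (𝕜 := ℝ) (hgm p.2)).abs)
  have hF5 : P.real F5 ≤ k * n * (2 * (1 / (n : ℝ) ^ 4)) := by
    refine (measureReal_biUnion_finset_le _ _).trans ?_
    calc _ ≤ ∑ p : Fin k × Fin n, 2 * (1 / (n : ℝ) ^ 4) := by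
          refine Finset.sum_le_sum fun p _ => ?_
          rw [← exp_neg_nat_mul_log hn0]
          refine measure_abs_inner_gt_le (hgm p.2) (hSm p.1 p.2) ?_
            (IsSubgaussianVec.sum_finset hind hg ((Finset.card_erase_le).trans (hσ p.1).le))
            (by positivity) hLpos (by positivity)
          have h1 := hind.indepFun_finsetSum_of_notMem hgm
            (Finset.notMem_erase p.2 (Finset.univ.filter (fun i => σ i = p.1)))
          convert! h1 using 1
          ext1 ω
          simp [S]
      _ = _ := by simp
  refine ⟨(F1 ∪ F2 ∪ F3 ∪ F4 ∪ F5)ᶜ,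
    ((((hF1m.union hF2m).union hF3m).union hF4m).union hF5m).compl, ?_, ?_⟩
  · rw [probReal_compl_eq_one_sub ((((hF1m.union hF2m).union hF3m).union hF4m).union hF5m)]
    -- The five events cost at most `1/n`, `1/n`, `1/(4n)`, `1/(4n)` and `1/(2n)`, in total `3/n`.
    have hU : P.real (F1 ∪ F2 ∪ F3 ∪ F4 ∪ F5) ≤
        P.real F1 + P.real F2 + P.real F3 + P.real F4 + P.real F5 := by
      refine (measureReal_union_le _ _).trans (add_le_add ?_ le_rfl)
      refine (measureReal_union_le _ _).trans (add_le_add ?_ le_rfl)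
      refine (measureReal_union_le _ _).trans (add_le_add ?_ le_rfl)
      exact measureReal_union_le _ _
    have h3 : (n : ℝ) * (1 / (n : ℝ) ^ 3) ≤ 1 / 4 * (1 / n) := by
      have : (n : ℝ) * (1 / (n : ℝ) ^ 3) = 1 / n * (1 / n) := by field_simp
      rw [this]
      gcongr
    have h4 : (k : ℝ) * (1 / (n : ℝ) ^ 3) ≤ n * (1 / (n : ℝ) ^ 3) := by gcongr
    have h5 : (k : ℝ) * n * (2 * (1 / (n : ℝ) ^ 4)) ≤ 2 * (n * (1 / (n : ℝ) ^ 3)) := by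
      calc _ ≤ (n : ℝ) * n * (2 * (1 / (n : ℝ) ^ 4)) := by gcongr
        _ = _ := by field_simp
    have h6 : 4 / (n : ℝ) = 4 * (1 / n) := by ring
    have h7 : 0 ≤ 1 / (n : ℝ) := by positivity
    linarith
  · intro ω hω
    simp only [Set.mem_compl_iff, Set.mem_union, not_or] at hω
    obtain ⟨⟨⟨⟨h1, h2⟩, h3⟩, h4⟩, h5⟩ := hω
    simp only [F1, F3, F4, F5, Set.mem_iUnion, Set.mem_ofPred_eq, Finset.mem_univ, exists_prop,
      true_and, not_exists, not_le, not_and, not_lt] at h1 h3 h4 h5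
    refine ⟨h1.le, hF2v ω h2, fun i => (h3 i).le, fun a => (h4 a).le, fun a j => ?_⟩
    have h6 := h5 (a, j) (h3 j).le
    simp only at h6
    have h7 : Real.sqrt (2 * (Real.toNNReal (8 * τ ^ 2) * m : ℝ≥0) * ((4 : ℕ) * Real.log n)) * L =
        112 * τ ^ 2 * Real.sqrt (m * Real.log n * (d + Real.log n)) := by
      push_cast
      rw [Real.coe_toNNReal _ (by positivity), hL, Real.sqrt_mul (by positivity) ((d : ℝ) + _),
        show 2 * (8 * τ ^ 2 * (m : ℝ)) * (4 * Real.log n) = (8 * τ) ^ 2 * (m * Real.log n) by ring,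
        Real.sqrt_mul (by positivity), Real.sqrt_sq (by positivity)]
      ring
    rw [h7] at h6
    have h8 : ‖g j ω‖ ^ 2 ≤ 196 * τ ^ 2 * (d + Real.log n) := by
      calc ‖g j ω‖ ^ 2 ≤ L ^ 2 := by gcongr; exact (h3 j).le
        _ = _ := by rw [hL, mul_pow, Real.sq_sqrt hΛ.le]; ring
    by_cases hj : σ j = a
    · have h9 : ∑ i ∈ Finset.univ.filter (fun i => σ i = a), g i ω = g j ω + S a j ω :=
        (Finset.add_sum_erase _ _ (by simpa using hj)).symm
      rw [h9, inner_add_left, real_inner_self_eq_norm_sq]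
      refine (abs_add_le _ _).trans ?_
      rw [abs_of_nonneg (sq_nonneg ‖g j ω‖)]
      linarith
    · have h9 : ∑ i ∈ Finset.univ.filter (fun i => σ i = a), g i ω = S a j ω := by
        simp only [S]
        rw [Finset.erase_eq_of_notMem (by simpa using hj)]
      rw [h9]
      have := sq_nonneg ‖g j ω‖
      linarith

end

/-! ### Error of the centers and bookkeeping of constants -/

section

variable {n k d : ℕ}

/-- The error of the mean of an estimated cluster in terms of the number of misplaced points. -/
theorem norm_centerEstimate_sub_le {m : ℕ} (hm : 0 < m) (hmk : (m : ℝ) = (n : ℝ) / k)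
    {σ σ' : Fin n → Fin k} {t c : Fin k}
    (hσ : (Finset.univ.filter (fun i => σ i = c)).card = m)
    (hσ' : (Finset.univ.filter (fun i => σ' i = t)).card = m)
    {μ : Fin k → EuclideanSpace ℝ (Fin d)} {g : Fin n → EuclideanSpace ℝ (Fin d)} {b δ L M : ℝ}
    (hb : ((Finset.univ.filter (fun i => σ' i = t ∧ σ i ≠ c)).card : ℝ) ≤ b)
    (hδ0 : 0 ≤ δ) (hL0 : 0 ≤ L) (hδ : ∀ a, ‖μ a - μ c‖ ≤ δ) (hL : ∀ i, ‖g i‖ ≤ L)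
    (hM : ‖∑ i ∈ Finset.univ.filter (fun i => σ i = c), g i‖ ≤ M) :
    ‖centerEstimate (sgmmData μ σ g) σ' t - μ c‖ ≤ (b * δ + M + 2 * b * L) / m := by
  classical
  have hm' : (0 : ℝ) < m := by exact_mod_cast hm
  set U := Finset.univ.filter (fun i => σ' i = t) with hU
  set C := Finset.univ.filter (fun i => σ i = c) with hC
  have hUC : Finset.univ.filter (fun i => σ' i = t ∧ σ i ≠ c) = U \ C := by
    ext i
    simp [hU, hC]
  rw [hUC] at hb
  -- `U` and `C` have the same size, so as many points are missing as are misplaced.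
  have hCU : ((C \ U).card : ℝ) ≤ b := by
    have h1 : (C \ U).card = (U \ C).card := by
      have h2 := Finset.card_sdiff_add_card_inter C U
      have h3 := Finset.card_sdiff_add_card_inter U C
      rw [Finset.inter_comm] at h3
      omega
    rw [h1]
    exact hb
  have hkn : (k : ℝ) / n = (m : ℝ)⁻¹ := by rw [hmk, inv_div]
  have hsum : centerEstimate (sgmmData μ σ g) σ' t - μ c =
      (m : ℝ)⁻¹ • (∑ i ∈ U \ C, (μ (σ i) - μ c) + ∑ i ∈ C, g i +
        (∑ i ∈ U \ C, g i - ∑ i ∈ C \ U, g i)) := by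
    have h1 : ∑ i ∈ U \ C, (μ (σ i) - μ c) = ∑ i ∈ U, (μ (σ i) - μ c) := by
      refine Finset.sum_subset Finset.sdiff_subset fun i hi hi' => ?_
      have : i ∈ C := by
        by_contra h
        exact hi' (Finset.mem_sdiff.mpr ⟨hi, h⟩)
      rw [(Finset.mem_filter.mp this).2, sub_self]
    have h2 : ∑ i ∈ C, g i + (∑ i ∈ U \ C, g i - ∑ i ∈ C \ U, g i) = ∑ i ∈ U, g i := by
      rw [← Finset.sum_inter_add_sum_sdiff C U g, ← Finset.sum_inter_add_sum_sdiff U C g,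
        Finset.inter_comm]
      abel
    have h3 : μ c = (m : ℝ)⁻¹ • ∑ i ∈ U, μ c := by
      rw [Finset.sum_const, hσ', ← Nat.cast_smul_eq_nsmul ℝ, smul_smul, inv_mul_cancel₀ hm'.ne',
        one_smul]
    rw [h1, add_assoc, h2, Finset.sum_sub_distrib]
    unfold centerEstimate
    rw [hkn]
    conv_lhs => rw [h3]
    rw [← smul_sub]
    congr 1
    simp only [sgmmData, Finset.sum_add_distrib]
    abel
  rw [hsum, norm_smul, norm_inv, Real.norm_of_nonneg hm'.le, inv_mul_eq_div]
  gcongr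
  have hn1 : ‖∑ i ∈ U \ C, (μ (σ i) - μ c)‖ ≤ b * δ := by
    refine (norm_sum_le_of_le _ fun i _ => hδ (σ i)).trans ?_
    rw [Finset.sum_const, nsmul_eq_mul]
    gcongr
  have hn2 : ‖∑ i ∈ U \ C, g i‖ ≤ b * L := by
    refine (norm_sum_le_of_le _ fun i _ => hL i).trans ?_
    rw [Finset.sum_const, nsmul_eq_mul]
    gcongr
  have hn3 : ‖∑ i ∈ C \ U, g i‖ ≤ b * L := by
    refine (norm_sum_le_of_le _ fun i _ => hL i).trans ?_
    rw [Finset.sum_const, nsmul_eq_mul]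
    gcongr
  have h1 := norm_add₃_le (a := ∑ i ∈ U \ C, (μ (σ i) - μ c)) (b := ∑ i ∈ C, g i)
    (c := ∑ i ∈ U \ C, g i - ∑ i ∈ C \ U, g i)
  have h2 := norm_sub_le (∑ i ∈ U \ C, g i) (∑ i ∈ C \ U, g i)
  linarith

/-- The minimum over permutations is taken separately for each `a`, so the transposition of `a` and
`c` suffices. -/
theorem centerError_le {ν μ : Fin k → EuclideanSpace ℝ (Fin d)} {ε : ℝ} (hk : 0 < k)
    (h : ∀ a, ∃ c, ‖ν a - μ c‖ ≤ ε) : centerError ν μ ≤ ε := by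
  have : Nonempty (Fin k) := ⟨⟨0, hk⟩⟩
  refine ciSup_le fun a => ?_
  obtain ⟨c, hc⟩ := h a
  refine (ciInf_le (Set.finite_range _).bddBelow (Equiv.swap a c)).trans ?_
  rwa [Equiv.swap_apply_left]

/-- The noise level is dominated by the separation under the condition on the signal-to-noise
ratio. -/
theorem noise_le_of_snrCondition {m : ℕ} (hn : 4 ≤ n) (hk : 0 < k) (hm : 0 < m) (hmk : m * k = n)
    {τ : ℝ} (hτ : 0 < τ) {μ : Fin k → EuclideanSpace ℝ (Fin d)}
    (hsnr : SNRCondition 30000 n k d (snr μ τ)) :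
    6 * ((112 * τ ^ 2 * Real.sqrt (m * Real.log n * (d + Real.log n)) +
      196 * τ ^ 2 * (d + Real.log n)) / m) + (28 * τ * Real.sqrt (n + d)) ^ 2 / m ≤
      minSep μ ^ 2 / 8 := by
  have hn' : (4 : ℝ) ≤ n := by exact_mod_cast hn
  have hm' : (0 : ℝ) < m := by exact_mod_cast hm
  have hk' : (1 : ℝ) ≤ k := by exact_mod_cast hk
  have hmkR : (m : ℝ) * k = n := by exact_mod_cast hmk
  have hlog : 0 < Real.log n := Real.log_pos (by linarith)
  have hlogn : Real.log n ≤ n := Real.log_le_self (by linarith)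
  have hlog2 : Real.log n ^ 2 ≤ 4 * n := by
    have h1 := Real.log_le_self (Real.sqrt_nonneg n)
    rw [Real.log_sqrt (by linarith)] at h1
    have h2 : Real.log n ≤ 2 * Real.sqrt n := by linarith
    calc Real.log n ^ 2 ≤ (2 * Real.sqrt n) ^ 2 := by gcongr
      _ = _ := by rw [mul_pow, Real.sq_sqrt (by linarith)]; ring
  have hd : (0 : ℝ) ≤ d := by positivity
  set A := Real.sqrt ((k : ℝ) * d / n * Real.log n) with hA
  -- Here `m² A² = m d log n`, and `log² n ≤ 4n = 4mk` bounds the remaining part by `(2mk)²`.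
  have hs : Real.sqrt (m * Real.log n * (d + Real.log n)) ≤ m * (A + 2 * k) := by
    refine Real.sqrt_le_iff.mpr ⟨by positivity, ?_⟩
    have h1 : A ^ 2 = (k : ℝ) * d / n * Real.log n := Real.sq_sqrt (by positivity)
    have h2 : (m : ℝ) ^ 2 * A ^ 2 = m * Real.log n * d := by
      rw [h1, ← hmkR]; field_simp
    have h3 : (m : ℝ) * Real.log n ^ 2 ≤ m ^ 2 * (4 * k ^ 2) := by
      calc (m : ℝ) * Real.log n ^ 2 ≤ m * (4 * (m * k)) := by rw [hmkR]; gcongr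
        _ = m ^ 2 * (4 * (k * 1)) := by ring
        _ ≤ m ^ 2 * (4 * (k * k)) := by gcongr
        _ = _ := by ring
    have h4 : 0 ≤ (m : ℝ) ^ 2 * (4 * (A * k)) := by positivity
    nlinarith
  have hs' : (112 * τ ^ 2 * Real.sqrt (m * Real.log n * (d + Real.log n)) +
      196 * τ ^ 2 * (d + Real.log n)) / m ≤
      τ ^ 2 * (112 * (A + 2 * k) + 196 * (k * d / n + k)) := by
    rw [div_le_iff₀ hm']
    have h1 : (k * d / n + k) * m = d + (n : ℝ) := by rw [← hmkR]; field_simp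
    have h2 : τ ^ 2 * Real.sqrt (m * Real.log n * (d + Real.log n)) ≤
      τ ^ 2 * (m * (A + 2 * k)) := by gcongr
    have h3 : τ ^ 2 * (d + Real.log n) ≤ τ ^ 2 * (d + n) := by gcongr
    rw [← h1] at h3
    linarith
  have ht : (28 * τ * Real.sqrt (n + d)) ^ 2 / m = τ ^ 2 * (784 * (k + k * d / n)) := by
    rw [mul_pow, Real.sq_sqrt (by positivity), ← hmkR]
    field_simp
    norm_num
  rw [ht]
  unfold SNRCondition snr at hsnr
  rw [div_pow, le_div_iff₀ (by positivity)] at hsnr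
  have h1 : 0 ≤ τ ^ 2 * A := by positivity
  have h2 : 0 ≤ τ ^ 2 * (k * d / n) := by positivity
  have h3 : 0 ≤ τ ^ 2 * (k : ℝ) := by positivity
  -- The largest coefficient, that of `k`, is `6 (224 + 196) + 784 = 3304`; times 8 it is 26432,
  -- below 30000.
  linarith

theorem le_snr_sq_of_snrCondition {s : ℝ} (h : SNRCondition 30000 n k d s) : (k : ℝ) ≤ s ^ 2 := by
  unfold SNRCondition at h
  have h1 : 0 ≤ Real.sqrt ((k : ℝ) * d / n * Real.log n) := Real.sqrt_nonneg _
  have h2 : 0 ≤ (k : ℝ) * d / n := by positivity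
  have h3 : 0 ≤ (k : ℝ) := by positivity
  linarith

/-- Half of the exponent absorbs the polynomial, through `y² / 2 ≤ exp y` at `y = s² / 16384`. -/
theorem pow_four_mul_exp_le (s : ℝ) :
    s ^ 4 * Real.exp (-(s ^ 2 / 8192)) ≤ 2 * 16384 ^ 2 * Real.exp (-(s ^ 2 / 16384)) := by
  have h1 := Real.quadratic_le_exp_of_nonneg (show 0 ≤ s ^ 2 / 16384 by positivity)
  have h2 : s ^ 4 ≤ 2 * 16384 ^ 2 * Real.exp (s ^ 2 / 16384) := by
    have : 0 ≤ s ^ 2 / 16384 := by positivity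
    nlinarith
  calc _ ≤ 2 * 16384 ^ 2 * Real.exp (s ^ 2 / 16384) * Real.exp (-(s ^ 2 / 8192)) := by gcongr
    _ = _ := by
      rw [mul_assoc, ← Real.exp_add]
      congr 2; ring

/-- The fraction of misplaced points of a cluster decays exponentially in the squared
signal-to-noise ratio. -/
theorem card_badRows_div_le {m : ℕ} (hn : 4 ≤ n) (hk : 0 < k) (hm : 0 < m) (hmk : m * k = n)
    {τ : ℝ} (hτ : 0 < τ) {μ : Fin k → EuclideanSpace ℝ (Fin d)} {σ : Fin n → Fin k}
    {g : Fin n → EuclideanSpace ℝ (Fin d)}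
    (hbal : ∀ a, ((Finset.univ.filter (fun i => σ i = a)).card : ℝ) = (n : ℝ) / k)
    (hsnr : SNRCondition 30000 n k d (snr μ τ))
    (hZ : ∑ j, noiseExcess τ μ (σ j) (g j) ≤ 2 * n * (k * Real.exp (-(snr μ τ ^ 2 / 8192))))
    (hop : ∀ v : EuclideanSpace ℝ (Fin n), ‖∑ i, v i • g i‖ ≤ 28 * τ * Real.sqrt (n + d) * ‖v‖)
    (hB : ∀ a j, |inner ℝ (∑ i ∈ Finset.univ.filter (fun i => σ i = a), g i) (g j)| ≤
        112 * τ ^ 2 * Real.sqrt (m * Real.log n * (d + Real.log n)) +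
          196 * τ ^ 2 * (d + Real.log n))
    {Y : Matrix (Fin n) (Fin n) ℝ} (hY : IsSDPSolution k (sgmmData μ σ g) Y) :
    ((badRows σ Y).card : ℝ) / m ≤
      65536 * (snr μ τ ^ 2 * Real.exp (-(snr μ τ ^ 2 / 8192))) := by
  have hm' : (0 : ℝ) < m := by exact_mod_cast hm
  have hk' : (1 : ℝ) ≤ k := by exact_mod_cast hk
  have hmkR : (m : ℝ) * k = n := by exact_mod_cast hmk
  have hnk : (n : ℝ) / k = m := by rw [← hmkR]; field_simp
  have h1 := hY.offClusterMass_le (τ := τ) hm' hnk hbal hτ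
    (fun a j => (hB a j).trans_eq (mul_div_cancel₀ _ hm'.ne').symm) hop
    (noise_le_of_snrCondition hn hk hm hmk hτ hsnr) (Y := Y)
  have h2 := (card_badRows_mul_le (σ := σ) (Y := Y)).trans_eq
    (sum_abs_sub_clusterMatrix hbal hY.1)
  set R := offClusterMass σ Y
  set s := snr μ τ with hs
  set q := Real.exp (-(s ^ 2 / 8192))
  have hq : 0 < q := Real.exp_pos _
  have hks := le_snr_sq_of_snrCondition hsnr
  have hspos : 0 < s ^ 2 := by linarith
  have hΔ : minSep μ = s * τ := by rw [hs, snr]; field_simp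
  -- Using `k ≤ s²` twice turns `k²` into `s⁴`, of which one `s²` cancels against the squared
  -- separation `s² τ²`.
  have hR : R ≤ 4096 * m ^ 2 * (s ^ 2 * q) := by
    rw [hΔ] at h1
    have h3 : s ^ 2 * τ ^ 2 * R ≤ s ^ 2 * τ ^ 2 * (4096 * m ^ 2 * (s ^ 2 * q)) := by
      calc s ^ 2 * τ ^ 2 * R ≤ 2048 * τ ^ 2 * m * (2 * n * (k * q)) := by
            rw [← mul_pow]
            exact h1.trans (by gcongr)
        _ = τ ^ 2 * (4096 * m ^ 2 * q) * (k * k) := by rw [← hmkR]; ring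
        _ ≤ τ ^ 2 * (4096 * m ^ 2 * q) * (s ^ 2 * s ^ 2) := by gcongr
        _ = _ := by ring
    exact le_of_mul_le_mul_left h3 (by positivity)
  have h3 : (n : ℝ) / (8 * k) = m / 8 := by rw [← hnk]; ring
  rw [h3] at h2
  rw [div_le_iff₀ hm']
  refine le_of_mul_le_mul_right ?_ hm'
  linarith

end

theorem theorem5 :
    ∃ Cs : ℝ, 0 < Cs ∧ ∀ Cq : ℝ, 0 < Cq → ∃ Cm Ce : ℝ, 0 < Cm ∧ 0 < Ce ∧
      ∀ (n k d : ℕ), 4 ≤ n → 2 ≤ k →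
      ∀ (Ω : Type*) [MeasurableSpace Ω] (P : Measure Ω) [IsProbabilityMeasure P]
        (τ : ℝ) (μ : Fin k → EuclideanSpace ℝ (Fin d)) (σ : Fin n → Fin k)
        (g : Fin n → Ω → EuclideanSpace ℝ (Fin d)),
      0 < τ → IsSGMM P τ σ g →
      (∀ a b, centerSep μ a b ≤ Cq * minSep μ) →
      SNRCondition Cs n k d (snr μ τ) →
      ∃ E : Set Ω, MeasurableSet E ∧ 1 - 4 / (n : ℝ) ≤ P.real E ∧
        ∀ ω ∈ E, ∀ Y : Matrix (Fin n) (Fin n) ℝ,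
          IsSDPSolution k (sgmmData μ σ (fun i => g i ω)) Y →
          ∀ σ' : Fin n → Fin k, IsClusterOutput Y σ' →
            centerError (centerEstimate (sgmmData μ σ (fun i => g i ω)) σ') μ ≤
              Cm * τ * (Real.sqrt ((k : ℝ) * (d + Real.log n) / n) +
                Real.sqrt (d + Real.log n) * Real.exp (-(snr μ τ ^ 2 / Ce))) := by
  -- In `Cm`, 14 comes from the noise average of a true cluster, `131072 * Cq` from the displaced
  -- centers and `65536 * 56` from the noise of misplaced or missing points; `2 * 16384 ^ 2` comes
  -- from `pow_four_mul_exp_le`.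
  refine ⟨30000, by norm_num, fun Cq hCq => ⟨14 + 2 * 16384 ^ 2 * (131072 * Cq + 65536 * 56), 16384,
    by positivity, by norm_num, ?_⟩⟩
  intro n k d hn hk Ω _ P _ τ μ σ g hτ hmod hsep hsnr
  have hk0 : 0 < k := by omega
  have hk' : (1 : ℝ) ≤ k := by exact_mod_cast hk0
  have hn' : (4 : ℝ) ≤ n := by exact_mod_cast hn
  -- Balancedness makes `n / k` an integer, being the size of a cluster.
  obtain ⟨m, hm⟩ : ∃ m : ℕ, (m : ℝ) = (n : ℝ) / k := ⟨_, hmod.balanced ⟨0, hk0⟩⟩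
  have hmkR : (m : ℝ) * k = n := by rw [hm]; field_simp
  have hmk : m * k = n := by exact_mod_cast hmkR
  have hm0 : 0 < m := Nat.pos_of_ne_zero (by rintro rfl; omega)
  have hm' : (0 : ℝ) < m := by exact_mod_cast hm0
  have hcard : ∀ a, (Finset.univ.filter (fun i => σ i = a)).card = m := fun a => by
    exact_mod_cast (hmod.balanced a).trans hm.symm
  obtain ⟨E, hE, hPE, hgood⟩ := exists_noise_event hn hm0 hmk hτ hmod.measurable hmod.indep
    (fun i => isSubgaussianVec_of_psi2NormVec_le hτ (hmod.measurable i) (hmod.mean_zero i)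
      (hmod.subgaussian i)) μ σ hcard
  refine ⟨E, hE, hPE, fun ω hω Y hY σ' hout => centerError_le hk0 fun t => ?_⟩
  obtain ⟨hZ, hop, hL, hM, hB⟩ := hgood ω hω
  have hbad := card_badRows_div_le hn hk0 hm0 hmk hτ hmod.balanced hsnr hZ hop hB hY
  obtain ⟨c, hc⟩ := hout.exists_card_le hmod.balanced hm t
  refine ⟨c, ?_⟩
  have hσ' : (Finset.univ.filter (fun i => σ' i = t)).card = m := by
    obtain ⟨_, _, _, _, _, hsize⟩ := hout
    exact_mod_cast (hsize t).trans hm.symm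
  have hlog : 1 ≤ Real.log n := by
    rw [Real.le_log_iff_exp_le (by linarith)]
    have := Real.exp_one_lt_d9
    linarith
  set Λ := (d : ℝ) + Real.log n with hΛ
  have hΛ1 : 1 ≤ Λ := by
    have : (0 : ℝ) ≤ d := by positivity
    linarith
  have hsΛ1 : 1 ≤ Real.sqrt Λ := Real.one_le_sqrt.mpr hΛ1
  set s := snr μ τ with hs
  have hs2 : 1 ≤ s ^ 2 := hk'.trans (le_snr_sq_of_snrCondition hsnr)
  have hs0 : 0 ≤ s := div_nonneg (minSep_nonneg μ) hτ.le
  have hs1 : 1 ≤ s := by nlinarith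
  have hΔ : minSep μ = s * τ := by rw [hs, snr]; field_simp
  have herr := norm_centerEstimate_sub_le hm0 hm (hcard c) hσ' (b := 2 * (badRows σ Y).card)
    (by exact_mod_cast hc) (mul_nonneg hCq.le (minSep_nonneg μ))
    ((norm_nonneg _).trans (hL ⟨0, by omega⟩)) (fun a => hsep a c) hL (hM c)
  refine herr.trans ?_
  set q := Real.exp (-(s ^ 2 / 8192)) with hq
  set x := ((badRows σ Y).card : ℝ) / m with hx
  have hq0 : 0 < q := Real.exp_pos _
  -- As `s ≥ 1`, all powers of `s` are raised to the fourth, so one decay estimate serves both error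
  -- terms.
  have hx4 : x * s ≤ 65536 * (s ^ 4 * q) := by
    calc x * s ≤ 65536 * (s ^ 2 * q) * s := by gcongr
      _ = 65536 * (s ^ 3 * q) := by ring
      _ ≤ 65536 * (s ^ 4 * q) := by
          gcongr
          norm_num
  have hx0 : 0 ≤ x := by positivity
  have hx4' : x ≤ 65536 * (s ^ 4 * q) := (le_mul_of_one_le_right hx0 hs1).trans hx4
  have hdecay := pow_four_mul_exp_le s
  rw [← hq] at hdecay
  set p := Real.exp (-(s ^ 2 / 16384)) with hp
  have hp0 : 0 < p := Real.exp_pos _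
  have hsq : Real.sqrt m * Real.sqrt Λ / m = Real.sqrt ((k : ℝ) * Λ / n) := by
    have h1 : (k : ℝ) * Λ / n = Λ / m := by rw [← hmkR]; field_simp
    rw [h1, Real.sqrt_div (by linarith), div_eq_div_iff hm'.ne' (Real.sqrt_pos.mpr hm').ne',
      mul_right_comm, Real.mul_self_sqrt hm'.le]
    ring
  have hsplit : (2 * ((badRows σ Y).card : ℝ) * (Cq * minSep μ) +
      Real.sqrt m * (14 * τ * Real.sqrt Λ) +
      2 * (2 * ((badRows σ Y).card : ℝ)) * (14 * τ * Real.sqrt Λ)) / m =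
      2 * Cq * τ * (x * s) + 14 * τ * Real.sqrt ((k : ℝ) * Λ / n) +
        56 * τ * Real.sqrt Λ * x := by
    rw [← hsq, hx, hΔ]
    field_simp
    ring
  rw [hsplit]
  have hA : 2 * Cq * τ * (x * s) ≤
      2 * Cq * τ * (65536 * (2 * 16384 ^ 2 * p)) * Real.sqrt Λ := by
    calc _ ≤ 2 * Cq * τ * (65536 * (2 * 16384 ^ 2 * p)) := by
          refine mul_le_mul_of_nonneg_left ?_ (by positivity)
          linarith
      _ ≤ _ := le_mul_of_one_le_right (by positivity) hsΛ1
  have hA' : 56 * τ * Real.sqrt Λ * x ≤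
      56 * τ * Real.sqrt Λ * (65536 * (2 * 16384 ^ 2 * p)) := by
    refine mul_le_mul_of_nonneg_left ?_ (by positivity)
    linarith
  have hw : 0 ≤ τ * (Real.sqrt Λ * p) := by positivity
  have hv : 0 ≤ τ * Real.sqrt ((k : ℝ) * Λ / n) := by positivity
  have hcoef : 0 ≤ 2 * 16384 ^ 2 * (131072 * Cq + 65536 * 56) *
      (τ * Real.sqrt ((k : ℝ) * Λ / n)) := by positivity
  linarith
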